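/- Let $p\ge 1$, $\delta>0$, $\sigma_w>0$, let $\beta\in\mathbb{R}^p$ be fixed, and let $Z\in\mathbb{R}^p$ have i.i.d. standard normal entries. For $\theta_1\ge\dots\ge\theta_p\ge 0$ put $J_\theta(b)=\sum_{i=1}^p\theta_i|b|_{(i)}$, where $|b|_{(1)}\ge\dots\ge|b|_{(p)}$ are the sorted magnitudes of the entries of $b$, and $\operatorname{prox}_{J_\theta}(y)=\arg\min_b \tfrac12\|y-b\|^2+J_\theta(b)$. For $\alpha$ in the cone $\mathcal{C}=\{\alpha\in\mathbb{R}^p:\alpha_1\ge\dots\ge\alpha_p\ge 0\}$ consider the state evolution equation $$\tau^2=\sigma_w^2+\frac{1}{\delta p}\,\mathbb{E}\bigl\|\operatorname{prox}_{J_{\alpha\tau}}(\beta+\tau Z)-\beta\bigr\|^2 ,\qquad \tau>0 .$$ Let $\alpha\in\mathcal{C}$ be such that this equation has a solution. Then the solution $\tau=\tau(\alpha)$ is unique. Write $\eta=\operatorname{prox}_{J_{\alpha\tau}}(\beta+\tau Z)$, let $I_j=\{k:|\eta_k|=|\eta_j|\}$, let $\sigma$ be a permutation of $\{1,\dots,p\}$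 with $|\eta|_{(i)}=|\eta_{\sigma(i)}|$ for all $i$, let $\operatorname{sgn}(0)=0$, and put $$D(\alpha,\tau)=-\delta p\,\tau+\sum_{j=1}^p\mathbb{E}\,\frac{1}{|I_j|}(\eta_j-\beta_j)\operatorname{sgn}(\eta_j)\sum_{k\in I_j}\bigl(\operatorname{sgn}(\eta_k)Z_k-\alpha_{\sigma^{-1}(k)}\bigr).$$ Then all the expectations here and below are those of integrable random variables, $D(\alpha,\tau)<0$, and the function $\tau(\cdot)$ is differentiable at $\alpha$ relative to $\mathcal{C}$ with $$\frac{\partial\tau}{\partial\alpha_i}=\mathbb{E}\left[\frac{1}{|I_{\sigma(i)}|\,D(\alpha,\tau)}\sum_{j\in I_{\sigma(i)}}(\eta_j-\beta_j)\operatorname{sgn}(\eta_j)\,\tau\right]\qquad(i=1,\dots,p),$$ that is, $\tau(\alpha')=\tau(\alpha)+\sum_{i=1}^p\frac{\partial\tau}{\partial\alpha_i}(\alpha'_i-\alpha_i)+o(\|\alpha'-\alpha\|)$ as $\alpha'\to\alpha$ in $\mathcal{C}$. In particular these are ordinary (two-sided) partial derivatives when $\alpha_1>\dots>\alpha_p>0$.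 -/

import Mathlib

open MeasureTheory ProbabilityTheory

noncomputable section

namespace SLOPE

variable {p : ℕ}

/-- The inverse ranking `σ` of the entries of `b` by magnitude: `|b (σ 1)| ≥ … ≥ |b (σ p)|`, so
that `|b (σ i)|` is the `i`-th largest magnitude `|b|_(i)`. -/
def ranking (b : Fin p → ℝ) : Equiv.Perm (Fin p) :=
  Tuple.sort fun j => -|b j|

/-- `ranking` indeed lists the magnitudes in decreasing order. -/
theorem antitone_abs_ranking (b : Fin p → ℝ) : Antitone fun i => |b (ranking b i)| := by
  intro i j hij
  have h := Tuple.monotone_sort (fun j => -|b j|) hij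
  simpa [ranking] using h

/-- The set `{k : |b k| = |b j|}` of coordinates that have the same magnitude as the `j`-th. -/
def levelSet (b : Fin p → ℝ) (j : Fin p) : Finset (Fin p) :=
  Finset.univ.filter fun k => |b k| = |b j|

/-- The sorted `ℓ¹` penalty `J_θ(b) = ∑ i, θ i * |b|_(i)`. -/
def sortedL1 (θ b : Fin p → ℝ) : ℝ :=
  ∑ i, θ i * |b (ranking b i)|

/-- `b` minimizes `½ ‖y - b‖² + J_θ(b)` (Euclidean norm). -/
def IsProx (θ y b : Fin p → ℝ) : Prop :=
  ∀ c : Fin p → ℝ,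
    (1 / 2) * ∑ j, (y j - b j) ^ 2 + sortedL1 θ b ≤ (1 / 2) * ∑ j, (y j - c j) ^ 2 + sortedL1 θ c

/-- The proximal operator of `J_θ`. For `θ 1 ≥ … ≥ θ p ≥ 0`, the only case in which it is used,
the function minimized is strictly convex and coercive, so the minimizer exists and is unique. -/
def prox (θ y : Fin p → ℝ) : Fin p → ℝ :=
  Classical.epsilon (IsProx θ y)

/-- The law of a vector of `p` independent standard normal variables. -/
def stdGaussian (p : ℕ) : Measure (Fin p → ℝ) :=
  Measure.pi fun _ => gaussianReal 0 1

/-- `η = prox_{J_{ατ}}(β + τ z)`. -/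
def eta (β α : Fin p → ℝ) (τ : ℝ) (z : Fin p → ℝ) : Fin p → ℝ :=
  prox (fun i => α i * τ) (fun j => β j + τ * z j)

/-- The state evolution equation
`τ² = σ_w² + (1 / (δ p)) E ‖prox_{J_{ατ}}(β + τ Z) - β‖²`. -/
def StateEvolution (σw δ : ℝ) (β α : Fin p → ℝ) (τ : ℝ) : Prop :=
  τ ^ 2 = σw ^ 2 + 1 / (δ * p) * ∫ z, ∑ j, (eta β α τ z j - β j) ^ 2 ∂stdGaussian p

/-- The positive solution `τ(α)` of the state evolution equation (`0` if there is none). -/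
def tau (σw δ : ℝ) (β α : Fin p → ℝ) : ℝ :=
  open Classical in
  if h : ∃ t : ℝ, 0 < t ∧ StateEvolution σw δ β α t then h.choose else 0

/-- The admissible penalties: `α 1 ≥ … ≥ α p ≥ 0`. -/
def penaltyCone (p : ℕ) : Set (Fin p → ℝ) :=
  {α | Antitone α ∧ ∀ i, 0 ≤ α i}

/-- The random variable
`|I_j|⁻¹ (η_j - β_j) sgn(η_j) ∑_{k ∈ I_j} (sgn(η_k) Z_k - α_{σ⁻¹(k)})` as a function of `Z = z`. -/
def denomTerm (β α : Fin p → ℝ) (τ : ℝ) (j : Fin p) (z : Fin p → ℝ) : ℝ :=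
  let η := eta β α τ z
  1 / ((levelSet η j).card : ℝ) * ((η j - β j) * Real.sign (η j)) *
    ∑ k ∈ levelSet η j, (Real.sign (η k) * z k - α ((ranking η).symm k))

/-- The denominator `D(α, τ)`, with `n = δ p`. -/
def denom (δ : ℝ) (β α : Fin p → ℝ) (τ : ℝ) : ℝ :=
  -(δ * p) * τ + ∑ j, ∫ z, denomTerm β α τ j z ∂stdGaussian p

/-- The random variable
`(|I_{σ(i)}| D(α, τ))⁻¹ ∑_{j ∈ I_{σ(i)}} (η_j - β_j) sgn(η_j) τ` as a function of `Z = z`. -/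
def gradTerm (δ : ℝ) (β α : Fin p → ℝ) (τ : ℝ) (i : Fin p) (z : Fin p → ℝ) : ℝ :=
  let η := eta β α τ z
  let I := levelSet η (ranking η i)
  1 / ((I.card : ℝ) * denom δ β α τ) * ∑ j ∈ I, (η j - β j) * Real.sign (η j) * τ

/-- The claimed value of `∂τ/∂α_i`: the expectation of `gradTerm` with respect to `Z`. -/
def grad (δ : ℝ) (β α : Fin p → ℝ) (τ : ℝ) (i : Fin p) : ℝ :=
  ∫ z, gradTerm δ β α τ i z ∂stdGaussian p

end SLOPE

end

noncomputable section

namespace SLOPE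

variable {p : ℕ}

/-! The state evolution equation says that `Γ(α, τ) = δp(τ² - σw²) - mse(α, τ)` vanishes, and the
theorem is the implicit function theorem for `Γ`, relative to the cone. Three facts are needed:
`mse` is differentiable, `∂Γ/∂τ = -2D` is nonzero, and the solution is unique and continuous in `α`.

Differentiability. Stationarity along level sets (`IsProx.eq_average`) shows that the prox is a
signed block average of `y - θ`, determined by a pattern (signs, level sets, ranking), of which
there are finitely many. Two pieces with different linear parts agree only on a hyperplane, a
Gaussian null set, so almost surely the pattern is constant near `(α, τ)` and the squared error is
there a polynomial (`hasFDerivWithinAt_sqErr`). The prox is Lipschitz jointly in its argument and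
penalty (`sum_sq_sub_le_of_isProx`), which gives an integrable dominating function and allows
differentiation under the expectation (`hasFDerivWithinAt_mse`).

Uniqueness. The scaled error `‖η - β‖ / τ` is nonincreasing in `τ` because subgradients of a convex
function are monotone (`sqErr_mul_sq_le`); hence `Γ / τ²` is strictly increasing, thanks to `σw >
0`. The sign changes of `Γ` at `τ ± ε` persist for nearby penalties and give continuity.

Sign of `D`. The sum of the `denomTerm`, times `τ`, is `‖η - β‖²` minus the squared distance from
`β` to its block projection (`mul_sum_denomTerm_le`), so on the solution `τ D ≤ -δpσw² < 0`. -/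

/-! ### The sorted `ℓ¹` penalty. -/

theorem sum_perm_le_sortedL1 {θ : Fin p → ℝ} (hθ : Antitone θ) (b : Fin p → ℝ)
    (π : Equiv.Perm (Fin p)) : ∑ i, θ i * |b (π i)| ≤ sortedL1 θ b := by
  have h := (hθ.monovary (antitone_abs_ranking b)).sum_mul_comp_perm_le_sum_mul
    (σ := π.trans (ranking b).symm)
  simpa [sortedL1] using h

theorem sortedL1_eq_of_antitone {θ : Fin p → ℝ} (hθ : Antitone θ) {b : Fin p → ℝ}
    {π : Equiv.Perm (Fin p)} (hπ : Antitone fun i => |b (π i)|) :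
    sortedL1 θ b = ∑ i, θ i * |b (π i)| := by
  refine le_antisymm ?_ (sum_perm_le_sortedL1 hθ b π)
  have h := (hθ.monovary hπ).sum_mul_comp_perm_le_sum_mul (σ := (ranking b).trans π.symm)
  simpa [sortedL1] using h

/-- By rearrangement the penalty is a maximum over permutations, and the ranking of `b + c` is a
competitor for both `b` and `c`. -/
theorem sortedL1_add_le {θ : Fin p → ℝ} (hθ : θ ∈ penaltyCone p) (b c : Fin p → ℝ) :
    sortedL1 θ (b + c) ≤ sortedL1 θ b + sortedL1 θ c := by
  refine le_trans ?_ (add_le_add (sum_perm_le_sortedL1 hθ.1 b (ranking (b + c)))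
    (sum_perm_le_sortedL1 hθ.1 c (ranking (b + c))))
  rw [← Finset.sum_add_distrib]
  refine Finset.sum_le_sum fun i _ => ?_
  rw [← mul_add]
  exact mul_le_mul_of_nonneg_left (abs_add_le _ _) (hθ.2 i)

theorem sortedL1_smul {θ : Fin p → ℝ} (hθ : Antitone θ) {t : ℝ} (ht : 0 ≤ t) (b : Fin p → ℝ) :
    sortedL1 θ (t • b) = t * sortedL1 θ b := by
  rw [sortedL1_eq_of_antitone hθ (π := ranking b), sortedL1, Finset.mul_sum]
  · refine Finset.sum_congr rfl fun i _ => ?_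
    simp [abs_mul, abs_of_nonneg ht]
    ring
  · intro i j hij
    simpa [abs_mul, abs_of_nonneg ht] using
      mul_le_mul_of_nonneg_left (antitone_abs_ranking b hij) ht

theorem sortedL1_mul_right (θ : Fin p → ℝ) (t : ℝ) (b : Fin p → ℝ) :
    sortedL1 (fun i => θ i * t) b = t * sortedL1 θ b := by
  simp only [sortedL1, Finset.mul_sum]
  exact Finset.sum_congr rfl fun i _ => by ring

theorem sortedL1_zero (θ : Fin p → ℝ) : sortedL1 θ 0 = 0 := by
  simp [sortedL1]

theorem sortedL1_nonneg {θ : Fin p → ℝ} (hθ : θ ∈ penaltyCone p) (b : Fin p → ℝ) :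
    0 ≤ sortedL1 θ b :=
  Finset.sum_nonneg fun i _ => mul_nonneg (hθ.2 i) (abs_nonneg _)

/-- Sorting magnitudes is nonexpansive: rearrangement controls the cross term. It makes the sorted
magnitudes continuous although the ranking jumps. -/
theorem sum_sq_sorted_sub_le (b c : Fin p → ℝ) :
    ∑ i, (|b (ranking b i)| - |c (ranking c i)|) ^ 2 ≤ ∑ i, (b i - c i) ^ 2 := by
  have h1 : ∑ k, |b k| * |c k| ≤ ∑ i, |b (ranking b i)| * |c (ranking c i)| := by
    rw [← Equiv.sum_comp (ranking b)]
    exact sum_perm_le_sortedL1 (antitone_abs_ranking b) c (ranking b)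
  have h2 : ∑ i, |b (ranking b i)| ^ 2 = ∑ k, |b k| ^ 2 :=
    Equiv.sum_comp (ranking b) fun k => |b k| ^ 2
  have h3 : ∑ i, |c (ranking c i)| ^ 2 = ∑ k, |c k| ^ 2 :=
    Equiv.sum_comp (ranking c) fun k => |c k| ^ 2
  calc ∑ i, (|b (ranking b i)| - |c (ranking c i)|) ^ 2
      = ∑ i, |b (ranking b i)| ^ 2 + ∑ i, |c (ranking c i)| ^ 2
        - 2 * ∑ i, |b (ranking b i)| * |c (ranking c i)| := by
        rw [Finset.mul_sum, ← Finset.sum_add_distrib, ← Finset.sum_sub_distrib]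
        exact Finset.sum_congr rfl fun i _ => by ring
    _ ≤ ∑ k, |b k| ^ 2 + ∑ k, |c k| ^ 2 - 2 * ∑ k, |b k| * |c k| := by rw [h2, h3]; linarith
    _ = ∑ k, (|b k| - |c k|) ^ 2 := by
        rw [Finset.mul_sum, ← Finset.sum_add_distrib, ← Finset.sum_sub_distrib]
        exact Finset.sum_congr rfl fun i _ => by ring
    _ ≤ ∑ k, (b k - c k) ^ 2 := Finset.sum_le_sum fun k _ =>
        sq_le_sq.2 (abs_abs_sub_abs_le _ _)

theorem continuous_sortedL1 (θ : Fin p → ℝ) : Continuous (sortedL1 θ) := by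
  refine continuous_finsetSum _ fun i _ => continuous_const.mul ?_
  rw [continuous_iff_continuousAt]
  intro b
  have h0 : Filter.Tendsto (fun c : Fin p → ℝ => Real.sqrt (∑ k, (c k - b k) ^ 2)) (nhds b)
      (nhds 0) := by
    have : Continuous fun c : Fin p → ℝ => Real.sqrt (∑ k, (c k - b k) ^ 2) := by fun_prop
    simpa using this.tendsto b
  refine tendsto_iff_dist_tendsto_zero.2 (squeeze_zero (fun _ => dist_nonneg) (fun c => ?_) h0)
  rw [Real.dist_eq]
  refine Real.abs_le_sqrt (le_trans ?_ (sum_sq_sorted_sub_le c b))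
  exact Finset.single_le_sum (f := fun i => (|c (ranking c i)| - |b (ranking b i)|) ^ 2)
    (fun _ _ => sq_nonneg _) (Finset.mem_univ i)

/-! ### Existence, uniqueness and stability of the proximal point. -/

theorem exists_isProx {θ : Fin p → ℝ} (hθ : θ ∈ penaltyCone p) (y : Fin p → ℝ) :
    ∃ b, IsProx θ y b := by
  have hc : Continuous fun b : Fin p → ℝ => (1 / 2) * ∑ j, (y j - b j) ^ 2 + sortedL1 θ b := by
    have := continuous_sortedL1 θ
    fun_prop
  refine hc.exists_forall_le' 0 ?_
  set Y := ∑ j, (y j) ^ 2 with hY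
  have hY0 : 0 ≤ Y := Finset.sum_nonneg fun _ _ => sq_nonneg _
  -- A coordinate with `|x i| ≥ 2‖y‖` is at distance at least `‖y‖` from `y i`, so the objective at
  -- `x` is no less than at `0`.
  filter_upwards [tendsto_norm_cocompact_atTop.eventually_ge_atTop (2 * Real.sqrt Y + 1)] with x hx
  obtain ⟨i, hi⟩ : ∃ i, 2 * Real.sqrt Y + 1 ≤ |x i| := by
    by_contra! h
    exact absurd ((pi_norm_lt_iff (by positivity)).2 h) (not_lt.2 hx)
  have h1 : (y i - x i) ^ 2 ≤ ∑ j, (y j - x j) ^ 2 :=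
    Finset.single_le_sum (f := fun j => (y j - x j) ^ 2) (fun _ _ => sq_nonneg _)
      (Finset.mem_univ i)
  have h2 : (y i) ^ 2 ≤ Y :=
    Finset.single_le_sum (f := fun j => (y j) ^ 2) (fun _ _ => sq_nonneg _) (Finset.mem_univ i)
  have h3 : 4 * Y ≤ (x i) ^ 2 := by
    rw [← sq_abs]
    nlinarith [Real.sq_sqrt hY0, Real.sqrt_nonneg Y]
  have h4 := sortedL1_nonneg hθ x
  simp only [sortedL1_zero, Pi.zero_apply, sub_zero]
  nlinarith [sq_nonneg (2 * y i - x i)]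

theorem isProx_prox {θ : Fin p → ℝ} (hθ : θ ∈ penaltyCone p) (y : Fin p → ℝ) :
    IsProx θ y (prox θ y) :=
  Classical.epsilon_spec (exists_isProx hθ y)

/-- The variational inequality characterizing the proximal operator. -/
theorem IsProx.sum_mul_le {θ y b : Fin p → ℝ} (hθ : θ ∈ penaltyCone p) (h : IsProx θ y b)
    (c : Fin p → ℝ) :
    ∑ j, (y j - b j) * (c j - b j) ≤ sortedL1 θ c - sortedL1 θ b := by
  by_contra! hlt
  set V := ∑ j, (y j - b j) * (c j - b j) with hV
  set W := ∑ j, (c j - b j) ^ 2 with hW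
  have hW0 : 0 ≤ W := Finset.sum_nonneg fun _ _ => sq_nonneg _
  set e := V - (sortedL1 θ c - sortedL1 θ b) with he
  have he0 : 0 < e := by linarith
  -- Small enough that the second-order gain `t W / 2` stays below the assumed defect `e`, and at
  -- most `1`.
  set t := e / (e + W + 1) with ht
  have ht0 : 0 < t := by positivity
  have ht1 : t ≤ 1 := by rw [ht, div_le_one (by positivity)]; linarith
  have hJ : sortedL1 θ ((1 - t) • b + t • c) ≤ (1 - t) * sortedL1 θ b + t * sortedL1 θ c := by
    rw [← sortedL1_smul hθ.1 (by linarith), ← sortedL1_smul hθ.1 ht0.le]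
    exact sortedL1_add_le hθ _ _
  have h1 := h ((1 - t) • b + t • c)
  have h2 : ∑ j, (y j - ((1 - t) • b + t • c) j) ^ 2
      = ∑ j, (y j - b j) ^ 2 - 2 * t * V + t ^ 2 * W := by
    rw [hV, hW, Finset.mul_sum, Finset.mul_sum, ← Finset.sum_sub_distrib,
      ← Finset.sum_add_distrib]
    refine Finset.sum_congr rfl fun j _ => ?_
    simp only [Pi.add_apply, Pi.smul_apply, smul_eq_mul]
    ring
  rw [h2] at h1
  have h3 : t * e ≤ t * (t * W / 2) := by rw [he]; nlinarith
  have h4 : e ≤ t * W / 2 := le_of_mul_le_mul_left h3 ht0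
  have h5 : t * (e + W + 1) = e := by rw [ht]; field_simp
  nlinarith [mul_pos ht0 he0]

/-- Add the two variational inequalities. The penalty terms regroup into `θ - θ'` paired with
differences of sorted magnitudes; two uses of Young's inequality with weight `1/4`, and
nonexpansiveness of sorting, absorb half of the left side. -/
theorem sum_sq_sub_le_of_isProx {θ θ' y y' b b' : Fin p → ℝ} (hθ : θ ∈ penaltyCone p)
    (hθ' : θ' ∈ penaltyCone p) (h : IsProx θ y b) (h' : IsProx θ' y' b') :
    ∑ j, (b j - b' j) ^ 2 ≤ 2 * ∑ j, (y j - y' j) ^ 2 + 2 * ∑ j, (θ j - θ' j) ^ 2 := by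
  have h1 := h.sum_mul_le hθ b'
  have h2 := h'.sum_mul_le hθ' b
  have h3 : ∑ j, (b j - b' j) ^ 2 = ∑ j, (y j - y' j) * (b j - b' j)
      + (∑ j, (y j - b j) * (b' j - b j) + ∑ j, (y' j - b' j) * (b j - b' j)) := by
    rw [← Finset.sum_add_distrib, ← Finset.sum_add_distrib]
    exact Finset.sum_congr rfl fun j _ => by ring
  have h4 : sortedL1 θ b' - sortedL1 θ b + (sortedL1 θ' b - sortedL1 θ' b')
      = ∑ i, (θ i - θ' i) * (|b' (ranking b' i)| - |b (ranking b i)|) := by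
    simp only [sortedL1]
    rw [← Finset.sum_sub_distrib, ← Finset.sum_sub_distrib, ← Finset.sum_add_distrib]
    exact Finset.sum_congr rfl fun j _ => by ring
  have h5 : ∑ j, (y j - y' j) * (b j - b' j)
      ≤ ∑ j, (y j - y' j) ^ 2 + 1 / 4 * ∑ j, (b j - b' j) ^ 2 := by
    rw [Finset.mul_sum, ← Finset.sum_add_distrib]
    refine Finset.sum_le_sum fun j _ => ?_
    nlinarith [sq_nonneg (2 * (y j - y' j) - (b j - b' j))]
  have h6 : ∑ i, (θ i - θ' i) * (|b' (ranking b' i)| - |b (ranking b i)|)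
      ≤ ∑ j, (θ j - θ' j) ^ 2 + 1 / 4 * ∑ j, (|b (ranking b j)| - |b' (ranking b' j)|) ^ 2 := by
    rw [Finset.mul_sum, ← Finset.sum_add_distrib]
    refine Finset.sum_le_sum fun j _ => ?_
    nlinarith [sq_nonneg (2 * (θ j - θ' j) + (|b (ranking b j)| - |b' (ranking b' j)|))]
  have h7 := sum_sq_sorted_sub_le b b'
  linarith

theorem IsProx.eq_prox {θ y b : Fin p → ℝ} (hθ : θ ∈ penaltyCone p) (h : IsProx θ y b) :
    b = prox θ y := by
  have h1 := sum_sq_sub_le_of_isProx hθ hθ h (isProx_prox hθ y)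
  simp only [sub_self, ne_eq, OfNat.ofNat_ne_zero, not_false_eq_true, zero_pow,
    Finset.sum_const_zero, mul_zero, add_zero] at h1
  funext j
  have h2 := (Finset.sum_eq_zero_iff_of_nonneg fun j _ => sq_nonneg (b j - prox θ y j)).1
    (le_antisymm h1 (Finset.sum_nonneg fun _ _ => sq_nonneg _)) j (Finset.mem_univ j)
  exact sub_eq_zero.1 (pow_eq_zero_iff two_ne_zero |>.1 h2)

theorem prox_zero {θ : Fin p → ℝ} (hθ : θ ∈ penaltyCone p) : prox θ 0 = 0 := by
  refine (IsProx.eq_prox hθ fun c => ?_).symm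
  have := sortedL1_nonneg hθ c
  have : 0 ≤ ∑ j, ((0 : Fin p → ℝ) j - c j) ^ 2 := Finset.sum_nonneg fun _ _ => sq_nonneg _
  simp only [sortedL1_zero, sub_self]
  simp only [ne_eq, OfNat.ofNat_ne_zero, not_false_eq_true, zero_pow, Finset.sum_const_zero]
  linarith

/-! ### Stationarity along level sets. -/

theorem sign_mul_self_eq_abs (x : ℝ) : Real.sign x * x = |x| := by
  rcases lt_trichotomy x 0 with h | h | h
  · rw [Real.sign_of_neg h, abs_of_neg h]; ring
  · simp [h]
  · rw [Real.sign_of_pos h, abs_of_pos h]; ring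

theorem sign_mul_abs_eq_self (x : ℝ) : Real.sign x * |x| = x := by
  rcases lt_trichotomy x 0 with h | h | h
  · rw [Real.sign_of_neg h, abs_of_neg h]; ring
  · simp [h]
  · rw [Real.sign_of_pos h, abs_of_pos h]; ring

theorem mem_levelSet {b : Fin p → ℝ} {j k : Fin p} : k ∈ levelSet b j ↔ |b k| = |b j| := by
  simp [levelSet]

theorem card_levelSet_pos (b : Fin p → ℝ) (j : Fin p) : (0 : ℝ) < (levelSet b j).card := by
  exact_mod_cast Finset.card_pos.2 ⟨j, mem_levelSet.2 rfl⟩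

/-- Moving a level set radially keeps the order of the magnitudes for a short time. -/
theorem eventually_sortedL1_shift {θ : Fin p → ℝ} (hθ : Antitone θ) (b : Fin p → ℝ) {j : Fin p}
    (hj : b j ≠ 0) :
    ∀ᶠ t in nhds (0 : ℝ),
      sortedL1 θ (fun k => b k + if k ∈ levelSet b j then t * Real.sign (b k) else 0)
        = sortedL1 θ b + t * ∑ k ∈ levelSet b j, θ ((ranking b).symm k) := by
  have habs : ∀ᶠ t in nhds (0 : ℝ), ∀ k, |b k + if k ∈ levelSet b j then t * Real.sign (b k) else 0|
      = |b k| + if k ∈ levelSet b j then t else 0 := by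
    have h1 : ∀ᶠ t in nhds (0 : ℝ), -|b j| < t := lt_mem_nhds (by simpa using hj)
    filter_upwards [h1] with t ht k
    split_ifs with hk
    · rw [mem_levelSet] at hk
      have hk0 : b k ≠ 0 := by rw [← abs_ne_zero, hk]; exact abs_ne_zero.2 hj
      rcases lt_or_gt_of_ne hk0 with h | h
      · rw [Real.sign_of_neg h, abs_of_neg h]
        rw [abs_of_neg h] at hk
        rw [abs_of_neg (by linarith)]; ring
      · rw [Real.sign_of_pos h, abs_of_pos h]
        rw [abs_of_pos h] at hk
        rw [abs_of_pos (by linarith)]; ring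
    · simp
  have hord : ∀ᶠ t in nhds (0 : ℝ), ∀ k l, |b k| < |b l| →
      |b k| + (if k ∈ levelSet b j then t else 0) ≤ |b l| + if l ∈ levelSet b j then t else 0 := by
    refine Filter.eventually_all.2 fun k => Filter.eventually_all.2 fun l => ?_
    by_cases hkl : |b k| < |b l|
    · have hc : Continuous fun t : ℝ => (|b l| + if l ∈ levelSet b j then t else 0) -
          (|b k| + (if k ∈ levelSet b j then t else 0)) := by
        split_ifs <;> fun_prop
      have := hc.tendsto 0
      simp only [ite_self, add_zero] at this
      filter_upwards [this.eventually (lt_mem_nhds (sub_pos.2 hkl))] with t ht _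
      linarith
    · exact Filter.Eventually.of_forall fun t h => absurd h hkl
  filter_upwards [habs, hord] with t ha ho
  -- Tied magnitudes move together, so the old ranking still sorts the moved vector.
  rw [sortedL1_eq_of_antitone hθ (π := ranking b)]
  · simp only [ha, mul_add, Finset.sum_add_distrib, sortedL1]
    congr 1
    rw [← Equiv.sum_comp (ranking b).symm]
    simp only [Equiv.apply_symm_apply, mul_ite, mul_zero, Finset.mul_sum]
    rw [← Finset.sum_filter]
    refine Finset.sum_congr (by ext k; simp) fun k _ => by ring
  · intro i l hil
    simp only [ha]
    rcases (antitone_abs_ranking b hil).lt_or_eq with h | h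
    · exact ho _ _ h
    · simp only at h
      simp only [mem_levelSet, h]; exact le_rfl

/-- Stationarity of the proximal point along its level sets. -/
theorem IsProx.eq_average {θ y b : Fin p → ℝ} (hθ : θ ∈ penaltyCone p) (h : IsProx θ y b)
    (j : Fin p) :
    b j = Real.sign (b j) / ((levelSet b j).card : ℝ) *
      ∑ k ∈ levelSet b j, (Real.sign (b k) * y k - θ ((ranking b).symm k)) := by
  by_cases hj : b j = 0
  · simp [hj]
  set T := ∑ k ∈ levelSet b j, θ ((ranking b).symm k) with hT
  set S := ∑ k ∈ levelSet b j, (y k - b k) * Real.sign (b k) with hS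
  -- The penalty is linear along this radial move, so the variational inequality holds for `t` of
  -- both signs and forces `S = T`.
  have hev : ∀ᶠ t in nhds (0 : ℝ), t * S ≤ t * T := by
    filter_upwards [eventually_sortedL1_shift hθ.1 b hj] with t ht
    have h1 := h.sum_mul_le hθ (fun k => b k + if k ∈ levelSet b j then t * Real.sign (b k) else 0)
    rw [ht] at h1
    simp only [add_sub_cancel_left, mul_ite, mul_zero] at h1
    rw [← Finset.sum_filter, Finset.filter_mem_eq_inter, Finset.univ_inter] at h1
    convert h1 using 1
    rw [hS, Finset.mul_sum]
    exact Finset.sum_congr rfl fun k _ => by ring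
  obtain ⟨ε, hε, hball⟩ := Metric.eventually_nhds_iff.1 hev
  have hp := hball (y := ε / 2) (by rw [Real.dist_eq, sub_zero, abs_of_pos] <;> linarith)
  have hm := hball (y := -(ε / 2)) (by rw [Real.dist_eq, sub_zero, abs_neg, abs_of_pos] <;> linarith)
  have hST : S = T := by
    refine le_antisymm (le_of_mul_le_mul_left hp (by linarith)) ?_
    exact le_of_mul_le_mul_left (a := ε / 2) (by linarith) (by linarith)
  have hsum : ∑ k ∈ levelSet b j, (Real.sign (b k) * y k - θ ((ranking b).symm k))
      = (levelSet b j).card * |b j| := by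
    rw [Finset.sum_sub_distrib, ← hT, ← hST, hS, ← Finset.sum_sub_distrib, ← nsmul_eq_mul,
      ← Finset.sum_const]
    refine Finset.sum_congr rfl fun k hk => ?_
    rw [← mem_levelSet.1 hk, ← sign_mul_self_eq_abs]
    ring
  have := card_levelSet_pos b j
  rw [hsum]
  field_simp
  exact (sign_mul_abs_eq_self _).symm

/-! ### Affine pieces of the proximal operator. -/

/-- Signs, level sets and ranking of a vector: the data on which the affine expression of the
proximal operator depends. -/
abbrev Pattern (p : ℕ) : Type :=
  (Fin p → SignType) × (Fin p → Finset (Fin p)) × Equiv.Perm (Fin p)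

def pattern (b : Fin p → ℝ) : Pattern p :=
  (fun j => SignType.sign (b j), levelSet b, ranking b)

/-- The block average of `y - θ` prescribed by a pattern. -/
def blockAverage (Q : Pattern p) (θ y : Fin p → ℝ) (j : Fin p) : ℝ :=
  (Q.1 j : ℝ) / ((Q.2.1 j).card : ℝ) *
    ∑ k ∈ Q.2.1 j, ((Q.1 k : ℝ) * y k - θ (Q.2.2.symm k))

/-- The matrix of the linear map `y ↦ blockAverage Q 0 y`. -/
def blockCoeff (Q : Pattern p) (j k : Fin p) : ℝ :=
  if k ∈ Q.2.1 j then (Q.1 j : ℝ) * (Q.1 k : ℝ) / ((Q.2.1 j).card : ℝ) else 0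

theorem coe_sign_eq (x : ℝ) : ((SignType.sign x : SignType) : ℝ) = Real.sign x := by
  rcases lt_trichotomy x 0 with h | h | h
  · simp [sign_neg h, Real.sign_of_neg h]
  · simp [h]
  · simp [sign_pos h, Real.sign_of_pos h]

theorem blockAverage_pattern (b θ y : Fin p → ℝ) (j : Fin p) :
    blockAverage (pattern b) θ y j = Real.sign (b j) / ((levelSet b j).card : ℝ) *
      ∑ k ∈ levelSet b j, (Real.sign (b k) * y k - θ ((ranking b).symm k)) := by
  simp [blockAverage, pattern, coe_sign_eq]

theorem prox_eq_blockAverage {θ : Fin p → ℝ} (hθ : θ ∈ penaltyCone p) (y : Fin p → ℝ) :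
    prox θ y = blockAverage (pattern (prox θ y)) θ y := by
  funext j
  rw [blockAverage_pattern]
  exact (isProx_prox hθ y).eq_average hθ j

theorem blockAverage_eq (Q : Pattern p) (θ y : Fin p → ℝ) (j : Fin p) :
    blockAverage Q θ y j = ∑ k, blockCoeff Q j k * y k + blockAverage Q θ 0 j := by
  simp only [blockAverage, blockCoeff, ite_mul, zero_mul, Finset.sum_ite_mem, Finset.univ_inter,
    Finset.mul_sum, Pi.zero_apply, mul_zero]
  rw [← Finset.sum_add_distrib]
  exact Finset.sum_congr rfl fun k _ => by ring

theorem continuous_blockAverage (Q : Pattern p) (j : Fin p) :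
    Continuous fun x : (Fin p → ℝ) × (Fin p → ℝ) => blockAverage Q x.1 x.2 j := by
  unfold blockAverage
  fun_prop

theorem tendsto_prox {θ : Fin p → ℝ} (hθ : θ ∈ penaltyCone p) (y : Fin p → ℝ) (j : Fin p) :
    Filter.Tendsto (fun x : (Fin p → ℝ) × (Fin p → ℝ) => prox x.1 x.2 j)
      (nhdsWithin (θ, y) (penaltyCone p ×ˢ Set.univ)) (nhds (prox θ y j)) := by
  have hc : Continuous fun x : (Fin p → ℝ) × (Fin p → ℝ) =>
      Real.sqrt (2 * ∑ j, (x.2 j - y j) ^ 2 + 2 * ∑ j, (x.1 j - θ j) ^ 2) := by fun_prop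
  have h0 := (hc.tendsto (θ, y)).mono_left
    (nhdsWithin_le_nhds (s := penaltyCone p ×ˢ Set.univ))
  simp only [sub_self, ne_eq, OfNat.ofNat_ne_zero, not_false_eq_true, zero_pow,
    Finset.sum_const_zero, mul_zero, add_zero, Real.sqrt_zero] at h0
  refine tendsto_iff_dist_tendsto_zero.2 (squeeze_zero' (Filter.Eventually.of_forall
    fun _ => dist_nonneg) ?_ h0)
  filter_upwards [self_mem_nhdsWithin] with x hx
  rw [Real.dist_eq]
  refine Real.abs_le_sqrt (le_trans ?_ (sum_sq_sub_le_of_isProx hx.1 hθ (isProx_prox hx.1 x.2)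
    (isProx_prox hθ y)))
  exact Finset.single_le_sum (f := fun j => (prox x.1 x.2 j - prox θ y j) ^ 2)
    (fun _ _ => sq_nonneg _) (Finset.mem_univ j)

/-- The entry `(j, k)` is nonzero exactly when `b j ≠ 0` and `k` lies in the level set of `j`, so
the matrix remembers the zeros and the nonzero level sets. -/
theorem levelSet_eq_of_blockCoeff_eq {b b' : Fin p → ℝ}
    (h : blockCoeff (pattern b') = blockCoeff (pattern b)) (j : Fin p) :
    (b' j = 0 ↔ b j = 0) ∧ (b j ≠ 0 → levelSet b' j = levelSet b j) := by
  have hmem : ∀ (c : Fin p → ℝ) (i k : Fin p), blockCoeff (pattern c) i k ≠ 0 ↔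
      c i ≠ 0 ∧ k ∈ levelSet c i := by
    intro c i k
    have := (card_levelSet_pos c i).ne'
    simp only [blockCoeff, pattern, coe_sign_eq, mem_levelSet]
    split_ifs with hk
    · have hk0 : c k = 0 ↔ c i = 0 := by rw [← abs_eq_zero, hk, abs_eq_zero]
      simp [Real.sign_eq_zero_iff, hk0, hk, -Finset.card_eq_zero, this]
    · simp [hk]
  have h0 : b' j = 0 ↔ b j = 0 := by
    have h1 := hmem b' j j
    have h2 := hmem b j j
    rw [h, h2] at h1
    simp only [mem_levelSet, and_true] at h1
    exact not_iff_not.1 h1.symm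
  refine ⟨h0, fun hj => ?_⟩
  ext k
  have h1 := hmem b' j k
  rw [h, hmem b j k] at h1
  have hj' : b' j ≠ 0 := fun h => hj (h0.1 h)
  simpa [hj, hj'] using h1.symm

/-- `Tuple.sort` breaks ties by index, so the ranking depends only on the weak order of the
magnitudes. -/
theorem ranking_eq_of_order {b b' : Fin p → ℝ} (hlt : ∀ j k, |b j| < |b k| → |b' j| < |b' k|)
    (heq : ∀ j k, |b j| = |b k| → |b' j| = |b' k|) : ranking b' = ranking b := by
  have h := (Tuple.eq_sort_iff (f := fun j => -|b j|) (σ := ranking b)).1 rfl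
  refine (Tuple.eq_sort_iff.2 ⟨fun i j hij => ?_, fun i j hij he => h.2 i j hij ?_⟩).symm
  · rcases (antitone_abs_ranking b hij).lt_or_eq with h1 | h1
    · simpa using (hlt _ _ h1).le
    · simpa using (heq _ _ h1).le
  · have h1 := antitone_abs_ranking b hij.le
    by_contra hne
    have h2 := hlt _ _ (lt_of_le_of_ne h1 fun h => hne (by rw [h]))
    exact h2.ne (neg_injective he).symm

/-- At a point where different affine pieces never meet, the pattern is locally constant. -/
theorem eventually_pattern_eq {θ : Fin p → ℝ} (hθ : θ ∈ penaltyCone p) (y : Fin p → ℝ)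
    (hgen : ∀ (Q Q' : Pattern p) (j : Fin p), blockCoeff Q j ≠ blockCoeff Q' j →
      blockAverage Q θ y j ≠ blockAverage Q' θ y j) :
    ∀ᶠ x in nhdsWithin (θ, y) (penaltyCone p ×ˢ Set.univ),
      pattern (prox x.1 x.2) = pattern (prox θ y) := by
  set b := prox θ y with hb
  -- There are finitely many patterns, so by continuity a piece that misses the prox at `(θ, y)`
  -- misses it nearby. The pattern at `x` must therefore be exact at `(θ, y)` too, and genericity
  -- gives it the same linear part.
  have hne : ∀ᶠ x in nhdsWithin (θ, y) (penaltyCone p ×ˢ (Set.univ : Set (Fin p → ℝ))),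
      ∀ (Q : Pattern p) j, blockAverage Q θ y j ≠ b j →
        blockAverage Q x.1 x.2 j ≠ prox x.1 x.2 j := by
    refine Filter.eventually_all.2 fun Q => Filter.eventually_all.2 fun j => ?_
    by_cases hj : blockAverage Q θ y j = b j
    · exact Filter.Eventually.of_forall fun x h => absurd hj h
    · have h1 := (((continuous_blockAverage Q j).tendsto (θ, y)).mono_left
        (nhdsWithin_le_nhds (s := penaltyCone p ×ˢ Set.univ))).sub (tendsto_prox hθ y j)
      filter_upwards [h1.eventually_ne (sub_ne_zero.2 hj)] with x hx _
      exact sub_ne_zero.1 hx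
  have hsgn : ∀ᶠ x in nhdsWithin (θ, y) (penaltyCone p ×ˢ (Set.univ : Set (Fin p → ℝ))),
      ∀ j, b j ≠ 0 → SignType.sign (prox x.1 x.2 j) = SignType.sign (b j) := by
    refine Filter.eventually_all.2 fun j => ?_
    rcases lt_trichotomy (b j) 0 with h | h | h
    · filter_upwards [(tendsto_prox hθ y j).eventually (gt_mem_nhds h)] with x hx _
      rw [sign_neg h, sign_neg hx]
    · exact Filter.Eventually.of_forall fun x h' => absurd h h'
    · filter_upwards [(tendsto_prox hθ y j).eventually (lt_mem_nhds h)] with x hx _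
      rw [sign_pos h, sign_pos hx]
  have hord : ∀ᶠ x in nhdsWithin (θ, y) (penaltyCone p ×ˢ (Set.univ : Set (Fin p → ℝ))),
      ∀ j k, |b j| < |b k| → |prox x.1 x.2 j| < |prox x.1 x.2 k| := by
    refine Filter.eventually_all.2 fun j => Filter.eventually_all.2 fun k => ?_
    by_cases h : |b j| < |b k|
    · filter_upwards [((tendsto_prox hθ y k).abs.sub (tendsto_prox hθ y j).abs).eventually
        (lt_mem_nhds (sub_pos.2 h))] with x hx _
      exact sub_pos.1 hx
    · exact Filter.Eventually.of_forall fun x h' => absurd h' h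
  filter_upwards [hne, hsgn, hord, self_mem_nhdsWithin] with x h1 h2 h3 hx
  set b' := prox x.1 x.2 with hb'
  have hcoeff : blockCoeff (pattern b') = blockCoeff (pattern b) := by
    funext j
    by_contra hj
    refine h1 (pattern b') j ?_ (congrFun (prox_eq_blockAverage hx.1 x.2) j).symm
    have h4 := hgen _ _ j hj
    rwa [show blockAverage (pattern b) θ y j = b j from
      (congrFun (prox_eq_blockAverage hθ y) j).symm] at h4
  have hlev := levelSet_eq_of_blockCoeff_eq hcoeff
  have heq : ∀ j k, |b j| = |b k| → |b' j| = |b' k| := by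
    intro j k hjk
    by_cases hk : b k = 0
    · have hj : b j = 0 := by rwa [hk, abs_zero, abs_eq_zero] at hjk
      rw [(hlev j).1.2 hj, (hlev k).1.2 hk]
    · rw [← mem_levelSet, (hlev k).2 hk, mem_levelSet]
      exact hjk
  have heq' : ∀ j k, |b' j| = |b' k| ↔ |b j| = |b k| := by
    intro j k
    refine ⟨fun h => ?_, heq j k⟩
    rcases lt_trichotomy |b j| |b k| with h' | h' | h'
    · exact absurd h (h3 _ _ h').ne
    · exact h'
    · exact absurd h (h3 _ _ h').ne'
  simp only [pattern, Prod.mk.injEq]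
  refine ⟨funext fun j => ?_, funext fun j => ?_, ranking_eq_of_order h3 heq⟩
  · by_cases hj : b j = 0
    · rw [hj, (hlev j).1.2 hj]
    · exact h2 j hj
  · ext k
    rw [mem_levelSet, mem_levelSet, heq']

/-! ### Gaussian null sets and differentiation under the integral. -/

instance : IsProbabilityMeasure (stdGaussian p) := by
  unfold stdGaussian; infer_instance

/-- A nontrivial affine equation has probability zero. -/
theorem ae_sum_mul_ne (c : Fin p → ℝ) (hc : c ≠ 0) (d : ℝ) :
    ∀ᵐ z ∂stdGaussian p, ∑ k, c k * z k ≠ d := by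
  obtain ⟨i, hi⟩ := Function.ne_iff.1 hc
  obtain ⟨n, rfl⟩ : ∃ n, p = n + 1 := ⟨p - 1, by have := i.pos; omega⟩
  have hmp := measurePreserving_piFinSuccAbove (fun _ : Fin (n + 1) => gaussianReal 0 1) i
  have hmeas : MeasurableSet {q : ℝ × (Fin n → ℝ) | c i * q.1 + ∑ k, c (i.succAbove k) * q.2 k ≠ d} := by
    refine (measurableSet_eq_fun ?_ ?_).compl <;> fun_prop
  have key : ∀ᵐ q ∂((gaussianReal 0 1).prod (Measure.pi fun _ : Fin n => gaussianReal 0 1)),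
      c i * q.1 + ∑ k, c (i.succAbove k) * q.2 k ≠ d := by
    -- With coordinate `i` in the inner integral, the other coordinates leave a single forbidden
    -- value, which has no mass.
    have hswap : ∀ᵐ q ∂((Measure.pi fun _ : Fin n => gaussianReal 0 1).prod (gaussianReal 0 1)),
      c i * q.2 + ∑ k, c (i.succAbove k) * q.1 k ≠ d := by
      rw [Measure.ae_prod_iff_ae_ae]
      · refine Filter.Eventually.of_forall fun v => ?_
        have : NullSingletonClass (gaussianReal 0 1) :=
          nullSingletonClass_gaussianReal one_ne_zero
        filter_upwards [Measure.ae_ne (gaussianReal 0 1)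
          ((d - ∑ k, c (i.succAbove k) * v k) / c i)] with u hu h
        apply hu
        rw [eq_div_iff hi]
        linarith
      · exact hmeas.preimage measurable_swap
    rw [← Measure.prod_swap]
    exact (ae_map_iff measurable_swap.aemeasurable hmeas).2 hswap
  have := hmp.quasiMeasurePreserving.ae key
  unfold stdGaussian
  filter_upwards [this] with z hz
  rw [Fin.sum_univ_succAbove _ i]
  exact hz

/-- Almost surely, different affine pieces never meet at `β + τ Z`. -/
theorem ae_blockAverage_ne (θ β : Fin p → ℝ) {τ : ℝ} (hτ : τ ≠ 0) :
    ∀ᵐ z ∂stdGaussian p, ∀ (Q Q' : Pattern p) (j : Fin p), blockCoeff Q j ≠ blockCoeff Q' j →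
      blockAverage Q θ (fun k => β k + τ * z k) j ≠ blockAverage Q' θ (fun k => β k + τ * z k) j := by
  refine ae_all_iff.2 fun Q => ae_all_iff.2 fun Q' => ae_all_iff.2 fun j => ?_
  by_cases h : blockCoeff Q j = blockCoeff Q' j
  · exact Filter.Eventually.of_forall fun z h' => absurd h h'
  have hc : (fun k => τ * (blockCoeff Q j k - blockCoeff Q' j k)) ≠ 0 := by
    intro h0
    apply h
    funext k
    have := congrFun h0 k
    simpa [hτ, sub_eq_zero] using this
  filter_upwards [ae_sum_mul_ne _ hc (blockAverage Q' θ β j - blockAverage Q θ β j)] with z hz _ he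
  apply hz
  rw [blockAverage_eq Q θ, blockAverage_eq Q' θ] at he
  rw [blockAverage_eq Q θ β, blockAverage_eq Q' θ β]
  have h1 : ∀ R : Pattern p, ∑ k, blockCoeff R j k * (β k + τ * z k)
      = ∑ k, blockCoeff R j k * β k + ∑ k, τ * blockCoeff R j k * z k := by
    intro R
    rw [← Finset.sum_add_distrib]
    exact Finset.sum_congr rfl fun k _ => by ring
  rw [h1, h1] at he
  have h2 : ∑ k, τ * (blockCoeff Q j k - blockCoeff Q' j k) * z k
      = ∑ k, τ * blockCoeff Q j k * z k - ∑ k, τ * blockCoeff Q' j k * z k := by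
    rw [← Finset.sum_sub_distrib]
    exact Finset.sum_congr rfl fun k _ => by ring
  rw [h2]
  linarith

/-- Dominated convergence for the normalized remainder. The version within a set is needed because
`α` may lie on the boundary of the cone. -/
theorem integral_hasFDerivWithinAt_of_dominated {Ω E : Type*} [MeasurableSpace Ω] {μ : Measure Ω}
    [NormedAddCommGroup E] [NormedSpace ℝ E] {S : Set E} {x₀ : E} (hx₀ : x₀ ∈ S)
    {F : E → Ω → ℝ} {F' : Ω → E →L[ℝ] ℝ} {K : Ω → ℝ} (hF : ∀ x ∈ S, Integrable (F x) μ)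
    (hF' : Integrable F' μ) (hK : Integrable K μ)
    (hlip : ∀ᶠ x in nhdsWithin x₀ S, ∀ a, |F x a - F x₀ a| ≤ K a * ‖x - x₀‖)
    (hd : ∀ᵐ a ∂μ, HasFDerivWithinAt (fun x => F x a) (F' a) S x₀) :
    HasFDerivWithinAt (fun x => ∫ a, F x a ∂μ) (∫ a, F' a ∂μ) S x₀ := by
  have hint : ∀ x ∈ S, Integrable (fun a => F x a - F x₀ a - F' a (x - x₀)) μ := fun x hx =>
    ((hF x hx).sub (hF x₀ hx₀)).sub (hF'.apply_continuousLinearMap _)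
  rw [hasFDerivWithinAt_iff_tendsto]
  have h1 : Filter.Tendsto (fun x => ∫ a, ‖x - x₀‖⁻¹ * ‖F x a - F x₀ a - F' a (x - x₀)‖ ∂μ)
      (nhdsWithin x₀ S) (nhds (∫ _, (0 : ℝ) ∂μ)) := by
    refine tendsto_integral_filter_of_dominated_convergence (fun a => |K a| + ‖F' a‖) ?_ ?_
      (hK.abs.add hF'.norm) ?_
    · filter_upwards [self_mem_nhdsWithin] with x hx
      exact ((hint x hx).norm.const_mul _).aestronglyMeasurable
    · filter_upwards [hlip] with x hx
      refine Filter.Eventually.of_forall fun a => ?_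
      rw [norm_mul, norm_inv, norm_norm, norm_norm]
      -- At `x = x₀` the quotient is `0`, since `0⁻¹ = 0`.
      rcases (norm_nonneg (x - x₀)).eq_or_lt with h0 | h0
      · rw [← h0, inv_zero, zero_mul]
        positivity
      · rw [inv_mul_le_iff₀ h0]
        refine (norm_sub_le _ _).trans ?_
        rw [mul_add]
        refine add_le_add ?_ ?_
        · rw [mul_comm]
          exact (hx a).trans (mul_le_mul_of_nonneg_right (le_abs_self _) h0.le)
        · rw [mul_comm]; exact (F' a).le_opNorm _
    · filter_upwards [hd] with a ha
      exact hasFDerivWithinAt_iff_tendsto.1 ha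
  rw [integral_zero] at h1
  refine squeeze_zero' (Filter.Eventually.of_forall fun x => by positivity) ?_ h1
  filter_upwards [self_mem_nhdsWithin] with x hx
  have h2 : ∫ a, F x a ∂μ - ∫ a, F x₀ a ∂μ - (∫ a, F' a ∂μ) (x - x₀)
      = ∫ a, (F x a - F x₀ a - F' a (x - x₀)) ∂μ := by
    rw [ContinuousLinearMap.integral_apply hF', ← integral_sub (hF x hx) (hF x₀ hx₀)]
    exact (integral_sub ((hF x hx).sub (hF x₀ hx₀)) (hF'.apply_continuousLinearMap _)).symm
  rw [integral_const_mul, h2]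
  exact mul_le_mul_of_nonneg_left (norm_integral_le_integral_norm _) (by positivity)

/-! ### Bounds on the squared error. -/

theorem mul_mem_penaltyCone {α : Fin p → ℝ} (hα : α ∈ penaltyCone p) {τ : ℝ} (hτ : 0 ≤ τ) :
    (fun i => α i * τ) ∈ penaltyCone p :=
  ⟨fun _ _ h => mul_le_mul_of_nonneg_right (hα.1 h) hτ, fun i => mul_nonneg (hα.2 i) hτ⟩

theorem continuous_eta (β : Fin p → ℝ) {α : Fin p → ℝ} (hα : α ∈ penaltyCone p) {τ : ℝ}
    (hτ : 0 ≤ τ) (j : Fin p) : Continuous fun z => eta β α τ z j := by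
  refine continuous_iff_continuousAt.2 fun z => ?_
  have hθ := mul_mem_penaltyCone hα hτ
  refine (tendsto_prox hθ (fun j => β j + τ * z j) j).comp (f := fun z : Fin p → ℝ =>
    ((fun i => α i * τ), fun j => β j + τ * z j)) (tendsto_nhdsWithin_iff.2 ⟨?_, ?_⟩)
  · exact Continuous.tendsto (by fun_prop) z
  · exact Filter.Eventually.of_forall fun _ => ⟨hθ, trivial⟩

/-- The squared estimation error `‖η - β‖²`. -/
def sqErr (β : Fin p → ℝ) (x : (Fin p → ℝ) × ℝ) (z : Fin p → ℝ) : ℝ :=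
  ∑ j, (eta β x.1 x.2 z j - β j) ^ 2

/-- Stability against `prox θ 0 = 0` gives `‖η‖² ≤ 2‖y‖²`; the rest is `(a + b)² ≤ 2a² + 2b²`. -/
theorem sqErr_le (β : Fin p → ℝ) {α : Fin p → ℝ} (hα : α ∈ penaltyCone p) {τ R : ℝ}
    (hτ : 0 ≤ τ) (hR : τ ≤ R) (z : Fin p → ℝ) :
    sqErr β (α, τ) z ≤ 10 * ∑ j, (β j) ^ 2 + 8 * R ^ 2 * ∑ j, (z j) ^ 2 := by
  have hθ := mul_mem_penaltyCone hα hτ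
  have h1 := sum_sq_sub_le_of_isProx hθ hθ (isProx_prox hθ (fun j => β j + τ * z j))
    (isProx_prox hθ 0)
  rw [prox_zero hθ] at h1
  simp only [Pi.zero_apply, sub_zero, sub_self, ne_eq, OfNat.ofNat_ne_zero, not_false_eq_true,
    zero_pow, Finset.sum_const_zero, mul_zero, add_zero] at h1
  have h2 : ∑ j, (β j + τ * z j) ^ 2 ≤ 2 * ∑ j, (β j) ^ 2 + 2 * R ^ 2 * ∑ j, (z j) ^ 2 := by
    rw [Finset.mul_sum, Finset.mul_sum, ← Finset.sum_add_distrib]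
    refine Finset.sum_le_sum fun j _ => ?_
    have : (τ * z j) ^ 2 ≤ R ^ 2 * (z j) ^ 2 := by
      rw [mul_pow]
      exact mul_le_mul_of_nonneg_right (pow_le_pow_left₀ hτ hR 2) (sq_nonneg _)
    nlinarith [sq_nonneg (β j - τ * z j)]
  have h3 : sqErr β (α, τ) z ≤ 2 * ∑ j, (eta β α τ z j) ^ 2 + 2 * ∑ j, (β j) ^ 2 := by
    rw [sqErr, Finset.mul_sum, Finset.mul_sum, ← Finset.sum_add_distrib]
    exact Finset.sum_le_sum fun j _ => by nlinarith [sq_nonneg (eta β α τ z j + β j)]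
  have h4 : ∑ j, (eta β α τ z j) ^ 2 ≤ 2 * ∑ j, (β j + τ * z j) ^ 2 := h1
  linarith

/-- A local Lipschitz bound whose constant is integrable in `z`; it dominates the difference
quotients. With `u` the difference and `v` the sum of the two errors, `u² = O(d²)` by stability, and
`2d|u v| ≤ u² + d²v²` leaves one factor `d` after division. -/
theorem abs_sqErr_sub_le (β : Fin p → ℝ) {R : ℝ} {x x' : (Fin p → ℝ) × ℝ}
    (hx : x ∈ penaltyCone p ×ˢ Set.Ioi 0) (hx' : x' ∈ penaltyCone p ×ˢ Set.Ioi 0)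
    (hR : ‖x‖ ≤ R) (hR' : ‖x'‖ ≤ R) (z : Fin p → ℝ) :
    |sqErr β x z - sqErr β x' z| ≤ ((1 + 16 * R ^ 2) * ∑ j, (z j) ^ 2 + 4 * p * R ^ 2
      + 20 * ∑ j, (β j) ^ 2) * ‖x - x'‖ := by
  obtain ⟨α, τ⟩ := x
  obtain ⟨α', τ'⟩ := x'
  obtain ⟨hα, hτ⟩ := hx
  obtain ⟨hα', hτ'⟩ := hx'
  simp only [Set.mem_Ioi] at hα hα' hτ hτ'
  set d := ‖((α, τ) : (Fin p → ℝ) × ℝ) - (α', τ')‖ with hd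
  have hτR : τ ≤ R := (le_abs_self τ).trans ((norm_snd_le (α, τ)).trans hR)
  have hτR' : τ' ≤ R := (le_abs_self τ').trans ((norm_snd_le (α', τ')).trans hR')
  have hαR : ∀ i, |α i| ≤ R := fun i =>
    (norm_le_pi_norm α i).trans ((norm_fst_le (α, τ)).trans hR)
  have hdτ : |τ - τ'| ≤ d := norm_snd_le (((α, τ) : (Fin p → ℝ) × ℝ) - (α', τ'))
  have hdα : ∀ i, |α i - α' i| ≤ d := fun i =>
    (norm_le_pi_norm (α - α') i).trans (norm_fst_le (((α, τ) : (Fin p → ℝ) × ℝ) - (α', τ')))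
  have hu : ∑ j, (eta β α τ z j - eta β α' τ' z j) ^ 2
      ≤ d ^ 2 * (2 * ∑ j, (z j) ^ 2 + 8 * p * R ^ 2) := by
    have h1 := mul_mem_penaltyCone hα hτ.le
    have h2 := mul_mem_penaltyCone hα' hτ'.le
    have h := sum_sq_sub_le_of_isProx h1 h2 (isProx_prox h1 (fun j => β j + τ * z j))
      (isProx_prox h2 (fun j => β j + τ' * z j))
    have h3 : ∑ j, ((β j + τ * z j) - (β j + τ' * z j)) ^ 2 ≤ d ^ 2 * ∑ j, (z j) ^ 2 := by
      rw [Finset.mul_sum]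
      refine Finset.sum_le_sum fun j _ => ?_
      have : (β j + τ * z j) - (β j + τ' * z j) = (τ - τ') * z j := by ring
      rw [this, mul_pow, ← sq_abs (τ - τ')]
      exact mul_le_mul_of_nonneg_right (pow_le_pow_left₀ (abs_nonneg _) hdτ 2) (sq_nonneg _)
    have h4 : ∑ i, (α i * τ - α' i * τ') ^ 2 ≤ p * (d ^ 2 * (4 * R ^ 2)) := by
      have : ∑ i : Fin p, d ^ 2 * (4 * R ^ 2) = p * (d ^ 2 * (4 * R ^ 2)) := by simp
      rw [← this]
      refine Finset.sum_le_sum fun i _ => ?_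
      have h5 : |α i * τ - α' i * τ'| ≤ 2 * R * d := by
        have : α i * τ - α' i * τ' = α i * (τ - τ') + τ' * (α i - α' i) := by ring
        rw [this]
        refine (abs_add_le _ _).trans ?_
        rw [abs_mul, abs_mul, abs_of_pos hτ']
        have := mul_le_mul (hαR i) hdτ (abs_nonneg _) ((abs_nonneg _).trans (hαR i))
        have := mul_le_mul hτR' (hdα i) (abs_nonneg _) (hτ'.le.trans hτR')
        linarith
      rw [← sq_abs]
      have := pow_le_pow_left₀ (abs_nonneg _) h5 2
      linarith
    calc _ ≤ _ := h
      _ ≤ 2 * (d ^ 2 * ∑ j, (z j) ^ 2) + 2 * (p * (d ^ 2 * (4 * R ^ 2))) := by linarith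
      _ = _ := by ring
  have hv : ∑ j, (eta β α τ z j + eta β α' τ' z j - 2 * β j) ^ 2
      ≤ 40 * ∑ j, (β j) ^ 2 + 32 * R ^ 2 * ∑ j, (z j) ^ 2 := by
    have h1 := sqErr_le β hα hτ.le hτR z
    have h2 := sqErr_le β hα' hτ'.le hτR' z
    have h3 : ∑ j, (eta β α τ z j + eta β α' τ' z j - 2 * β j) ^ 2
        ≤ 2 * sqErr β (α, τ) z + 2 * sqErr β (α', τ') z := by
      simp only [sqErr]
      rw [Finset.mul_sum, Finset.mul_sum, ← Finset.sum_add_distrib]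
      exact Finset.sum_le_sum fun j _ => by
        nlinarith [sq_nonneg (eta β α τ z j - eta β α' τ' z j)]
    linarith
  rcases (norm_nonneg (((α, τ) : (Fin p → ℝ) × ℝ) - (α', τ'))).eq_or_lt with h0 | h0
  · have : ((α, τ) : (Fin p → ℝ) × ℝ) = (α', τ') := sub_eq_zero.1 (norm_eq_zero.1 h0.symm)
    rw [hd, ← h0, this]
    simp
  · rw [← hd] at h0
    have h1 : 2 * d * |sqErr β (α, τ) z - sqErr β (α', τ') z|
        ≤ ∑ j, (eta β α τ z j - eta β α' τ' z j) ^ 2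
          + d ^ 2 * ∑ j, (eta β α τ z j + eta β α' τ' z j - 2 * β j) ^ 2 := by
      simp only [sqErr]
      rw [← Finset.sum_sub_distrib, Finset.mul_sum (s := Finset.univ) (a := d ^ 2),
        ← Finset.sum_add_distrib]
      refine (mul_le_mul_of_nonneg_left (Finset.abs_sum_le_sum_abs _ _) (by linarith)).trans ?_
      rw [Finset.mul_sum]
      refine Finset.sum_le_sum fun j _ => ?_
      have : (eta β α τ z j - β j) ^ 2 - (eta β α' τ' z j - β j) ^ 2
        = (eta β α τ z j - eta β α' τ' z j) * (eta β α τ z j + eta β α' τ' z j - 2 * β j) := by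
        ring
      rw [this, abs_mul, ← sq_abs (eta β α τ z j - eta β α' τ' z j),
        ← sq_abs (eta β α τ z j + eta β α' τ' z j - 2 * β j)]
      nlinarith [sq_nonneg (|eta β α τ z j - eta β α' τ' z j|
        - d * |eta β α τ z j + eta β α' τ' z j - 2 * β j|)]
    have h2 : d * (2 * |sqErr β (α, τ) z - sqErr β (α', τ') z|)
        ≤ d * (d * (2 * ∑ j, (z j) ^ 2 + 8 * p * R ^ 2
          + (40 * ∑ j, (β j) ^ 2 + 32 * R ^ 2 * ∑ j, (z j) ^ 2))) := by
      have := mul_le_mul_of_nonneg_left hv (sq_nonneg d)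
      calc _ = 2 * d * |sqErr β (α, τ) z - sqErr β (α', τ') z| := by ring
        _ ≤ _ := h1
        _ ≤ d ^ 2 * (2 * ∑ j, (z j) ^ 2 + 8 * p * R ^ 2)
          + d ^ 2 * (40 * ∑ j, (β j) ^ 2 + 32 * R ^ 2 * ∑ j, (z j) ^ 2) := by linarith
        _ = _ := by ring
    have h3 := le_of_mul_le_mul_left h2 h0
    linarith

theorem integrable_sum_sq : Integrable (fun z : Fin p → ℝ => ∑ j, (z j) ^ 2) (stdGaussian p) := by
  refine integrable_finsetSum _ fun j _ => ?_
  have h : MemLp id 2 (gaussianReal 0 1) := by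
    simpa using memLp_id_gaussianReal (μ := 0) (v := 1) 2
  exact integrable_comp_eval (μ := fun _ : Fin p => gaussianReal 0 1) (i := j) h.integrable_sq

theorem integrable_sqErr (β : Fin p → ℝ) {x : (Fin p → ℝ) × ℝ}
    (hx : x ∈ penaltyCone p ×ˢ Set.Ioi (0 : ℝ)) : Integrable (sqErr β x) (stdGaussian p) := by
  have hx2 : 0 < x.2 := hx.2
  have hc : Continuous (sqErr β x) := by
    have := fun j => continuous_eta β hx.1 hx2.le j
    unfold sqErr
    fun_prop
  refine Integrable.mono' ((integrable_const (10 * ∑ j, (β j) ^ 2)).add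
    (integrable_sum_sq.const_mul (8 * x.2 ^ 2))) hc.aestronglyMeasurable
    (Filter.Eventually.of_forall fun z => ?_)
  rw [Real.norm_of_nonneg (show 0 ≤ sqErr β x z from Finset.sum_nonneg fun _ _ => sq_nonneg _)]
  exact sqErr_le β hx.1 hx2.le le_rfl z

/-! ### Measurability and integrability of the terms in the formula. -/

theorem measurable_real_sign : Measurable Real.sign := by
  unfold Real.sign
  exact Measurable.ite measurableSet_Iio measurable_const
    (Measurable.ite measurableSet_Ioi measurable_const measurable_const)

/-- A family of measurable functions, selected by the ranking of a measurable vector, is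
measurable. -/
theorem measurable_ranking_select {Ω : Type*} [MeasurableSpace Ω] {η : Ω → Fin p → ℝ}
    (hη : ∀ j, Measurable fun z => η z j) {f : Equiv.Perm (Fin p) → Ω → ℝ}
    (hf : ∀ π, Measurable (f π)) : Measurable fun z => f (ranking (η z)) z := by
  classical
  have hset : ∀ π : Equiv.Perm (Fin p), MeasurableSet {z | π = ranking (η z)} := by
    intro π
    -- A given permutation is the ranking exactly when it sorts and breaks ties by index: finitely
    -- many measurable conditions.
    have : {z | π = ranking (η z)} = (⋂ i, ⋂ j, {z | i ≤ j → -|η z (π i)| ≤ -|η z (π j)|}) ∩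
        ⋂ i, ⋂ j, {z | i < j → -|η z (π i)| = -|η z (π j)| → π i < π j} := by
      ext z
      simp only [ranking, Set.mem_ofPred_eq, Tuple.eq_sort_iff, Set.mem_inter_iff, Set.mem_iInter,
        Monotone, Function.comp]
    rw [this]
    refine (MeasurableSet.iInter fun i => MeasurableSet.iInter fun j => ?_).inter
      (MeasurableSet.iInter fun i => MeasurableSet.iInter fun j => ?_)
    · exact (MeasurableSet.const _).imp (measurableSet_le (hη _).abs.neg (hη _).abs.neg)
    · exact (MeasurableSet.const _).imp
        ((measurableSet_eq_fun (hη _).abs.neg (hη _).abs.neg).imp (MeasurableSet.const _))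
  have hsum : (fun z => f (ranking (η z)) z)
      = fun z => ∑ π, if π = ranking (η z) then f π z else 0 := by
    funext z; simp
  rw [hsum]
  exact Finset.measurable_sum _ fun π _ => Measurable.ite (hset π) (hf π) measurable_const

theorem measurable_sum_levelSet {Ω : Type*} [MeasurableSpace Ω] {η : Ω → Fin p → ℝ}
    (hη : ∀ j, Measurable fun z => η z j) (j : Fin p) {f : Fin p → Ω → ℝ}
    (hf : ∀ k, Measurable (f k)) : Measurable fun z => ∑ k ∈ levelSet (η z) j, f k z := by
  simp only [levelSet, Finset.sum_filter]
  exact Finset.measurable_sum _ fun k _ => Measurable.ite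
    (measurableSet_eq_fun (hη k).abs (hη j).abs) (hf k) measurable_const

theorem measurable_card_levelSet {Ω : Type*} [MeasurableSpace Ω] {η : Ω → Fin p → ℝ}
    (hη : ∀ j, Measurable fun z => η z j) (j : Fin p) :
    Measurable fun z => ((levelSet (η z) j).card : ℝ) := by
  have : ∀ z, ((levelSet (η z) j).card : ℝ) = ∑ _k ∈ levelSet (η z) j, (1 : ℝ) := fun z => by simp
  simp only [this]
  exact measurable_sum_levelSet hη j fun _ => measurable_const

theorem abs_sign_le_one (x : ℝ) : |Real.sign x| ≤ 1 := by
  rcases Real.sign_apply_eq x with h | h | h <;> simp [h]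

theorem one_div_card_levelSet_le_one (b : Fin p → ℝ) (j : Fin p) :
    |1 / ((levelSet b j).card : ℝ)| ≤ 1 := by
  have h := card_levelSet_pos b j
  rw [abs_of_pos (by positivity), div_le_one h]
  exact_mod_cast h

theorem integrable_denomTerm (β : Fin p → ℝ) {α : Fin p → ℝ} (hα : α ∈ penaltyCone p) {τ : ℝ}
    (hτ : 0 < τ) (j : Fin p) : Integrable (denomTerm β α τ j) (stdGaussian p) := by
  have hη : ∀ j, Measurable fun z => eta β α τ z j := fun j =>
    (continuous_eta β hα hτ.le j).measurable
  have hmeas : Measurable (denomTerm β α τ j) := by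
    refine measurable_ranking_select hη (f := fun π z =>
      1 / ((levelSet (eta β α τ z) j).card : ℝ) *
        ((eta β α τ z j - β j) * Real.sign (eta β α τ z j)) *
        ∑ k ∈ levelSet (eta β α τ z) j, (Real.sign (eta β α τ z k) * z k - α (π.symm k)))
      fun π => ?_
    refine (((measurable_card_levelSet hη j).const_div 1).mul
      (((hη j).sub_const _).mul (measurable_real_sign.comp (hη j)))).mul
      (measurable_sum_levelSet hη j fun k => ?_)
    exact ((measurable_real_sign.comp (hη k)).mul (measurable_pi_apply k)).sub_const _
  have hbound : Integrable (fun z => sqErr β (α, τ) z + (p * ∑ k, (z k) ^ 2 + p * (p * ‖α‖ ^ 2)))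
      (stdGaussian p) :=
    (integrable_sqErr β (x := (α, τ)) ⟨hα, hτ⟩).add
      ((integrable_sum_sq.const_mul _).add (integrable_const _))
  refine hbound.mono' hmeas.aestronglyMeasurable (Filter.Eventually.of_forall fun z => ?_)
  set η := eta β α τ z with hηz
  have h1 : |∑ k ∈ levelSet η j, (Real.sign (η k) * z k - α ((ranking η).symm k))|
      ≤ ∑ k, (|z k| + ‖α‖) := by
    refine (Finset.abs_sum_le_sum_abs _ _).trans ((Finset.sum_le_sum fun k _ => ?_).trans
      (Finset.sum_le_sum_of_subset_of_nonneg (Finset.subset_univ _) fun _ _ _ => by positivity))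
    refine (abs_sub _ _).trans (add_le_add ?_ (norm_le_pi_norm α _))
    rw [abs_mul]
    exact mul_le_of_le_one_left (abs_nonneg _) (abs_sign_le_one _)
  have h2 : (∑ k, (|z k| + ‖α‖)) ^ 2 ≤ 2 * (p * ∑ k, (z k) ^ 2 + p * (p * ‖α‖ ^ 2)) := by
    refine sq_sum_le_card_mul_sum_sq.trans ?_
    have : ∑ k, (|z k| + ‖α‖) ^ 2 ≤ 2 * (∑ k, (z k) ^ 2 + p * ‖α‖ ^ 2) := by
      have h3 : ∑ _k : Fin p, ‖α‖ ^ 2 = p * ‖α‖ ^ 2 := by simp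
      rw [← h3, ← Finset.sum_add_distrib, Finset.mul_sum]
      refine Finset.sum_le_sum fun k _ => ?_
      rw [← sq_abs (z k)]
      nlinarith [sq_nonneg (|z k| - ‖α‖)]
    calc _ ≤ (p : ℝ) * (2 * (∑ k, (z k) ^ 2 + p * ‖α‖ ^ 2)) := by
          rw [Finset.card_univ, Fintype.card_fin]
          exact mul_le_mul_of_nonneg_left this (by positivity)
      _ = _ := by ring
  have h3 : (η j - β j) ^ 2 ≤ sqErr β (α, τ) z :=
    Finset.single_le_sum (f := fun j => (η j - β j) ^ 2) (fun _ _ => sq_nonneg _)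
      (Finset.mem_univ j)
  have h4 : |denomTerm β α τ j z| ≤ |η j - β j| * ∑ k, (|z k| + ‖α‖) := by
    simp only [denomTerm, abs_mul, ← hηz]
    refine mul_le_mul ?_ h1 (abs_nonneg _) (abs_nonneg _)
    refine (mul_le_of_le_one_left (by positivity) (one_div_card_levelSet_le_one η j)).trans ?_
    exact mul_le_of_le_one_right (abs_nonneg _) (abs_sign_le_one _)
  rw [Real.norm_eq_abs]
  rw [← sq_abs] at h3
  nlinarith [sq_nonneg (|η j - β j| - ∑ k, (|z k| + ‖α‖)), sq_nonneg (|η j - β j|)]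

/-- `gradTerm` without the factor `1 / D(α, τ)`. -/
def gradNumer (β α : Fin p → ℝ) (τ : ℝ) (i : Fin p) (z : Fin p → ℝ) : ℝ :=
  let η := eta β α τ z
  let I := levelSet η (ranking η i)
  1 / (I.card : ℝ) * ∑ j ∈ I, (η j - β j) * Real.sign (η j) * τ

theorem gradTerm_eq (δ : ℝ) (β α : Fin p → ℝ) (τ : ℝ) (i : Fin p) (z : Fin p → ℝ) :
    gradTerm δ β α τ i z = (denom δ β α τ)⁻¹ * gradNumer β α τ i z := by
  simp only [gradTerm, gradNumer, one_div, mul_inv]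
  ring

theorem integrable_gradNumer (β : Fin p → ℝ) {α : Fin p → ℝ} (hα : α ∈ penaltyCone p) {τ : ℝ}
    (hτ : 0 < τ) (i : Fin p) : Integrable (gradNumer β α τ i) (stdGaussian p) := by
  have hη : ∀ j, Measurable fun z => eta β α τ z j := fun j =>
    (continuous_eta β hα hτ.le j).measurable
  have hmeas : Measurable (gradNumer β α τ i) := by
    refine measurable_ranking_select hη (f := fun π z =>
      1 / ((levelSet (eta β α τ z) (π i)).card : ℝ) *
        ∑ j ∈ levelSet (eta β α τ z) (π i),
          (eta β α τ z j - β j) * Real.sign (eta β α τ z j) * τ)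
      fun π => ?_
    refine ((measurable_card_levelSet hη _).const_div 1).mul
      (measurable_sum_levelSet hη _ fun j => ?_)
    exact (((hη j).sub_const _).mul (measurable_real_sign.comp (hη j))).mul_const _
  have hbound : Integrable (fun z => (sqErr β (α, τ) z + p) * τ) (stdGaussian p) :=
    ((integrable_sqErr β (x := (α, τ)) ⟨hα, hτ⟩).add (integrable_const _)).mul_const _
  refine hbound.mono' hmeas.aestronglyMeasurable (Filter.Eventually.of_forall fun z => ?_)
  simp only [gradNumer]
  set η := eta β α τ z with hηz
  rw [Real.norm_eq_abs, abs_mul]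
  refine (mul_le_of_le_one_left (abs_nonneg _) (one_div_card_levelSet_le_one η _)).trans ?_
  refine (Finset.abs_sum_le_sum_abs _ _).trans ?_
  have h1 : (sqErr β (α, τ) z + p) * τ = ∑ j, ((η j - β j) ^ 2 + 1) * τ := by
    rw [← Finset.sum_mul, Finset.sum_add_distrib]; simp [sqErr, hηz]
  rw [h1]
  refine (Finset.sum_le_sum fun j _ => ?_).trans
    (Finset.sum_le_sum_of_subset_of_nonneg (Finset.subset_univ _) fun _ _ _ => by positivity)
  rw [abs_mul, abs_mul, abs_of_pos hτ]
  refine mul_le_mul_of_nonneg_right ?_ hτ.le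
  refine (mul_le_of_le_one_right (abs_nonneg _) (abs_sign_le_one _)).trans ?_
  rw [← sq_abs]
  nlinarith [sq_nonneg (|η j - β j| - 1)]

/-! ### Derivatives of the squared error and of its mean. -/

/-- The derivative of the squared error in `(α, τ)`. -/
def sqErrDeriv (β α : Fin p → ℝ) (τ : ℝ) (z : Fin p → ℝ) : (Fin p → ℝ) × ℝ →L[ℝ] ℝ :=
  (2 * ∑ j, denomTerm β α τ j z) • ContinuousLinearMap.snd ℝ (Fin p → ℝ) ℝ -
    ∑ i, (2 * gradNumer β α τ i z) •
      (ContinuousLinearMap.proj i : (Fin p → ℝ) →L[ℝ] ℝ).comp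
        (ContinuousLinearMap.fst ℝ (Fin p → ℝ) ℝ)

/-- Exchanges the sums over pairs of equal magnitude and reindexes by rank, turning the chain rule
output, grouped by coordinate, into the coefficients of `a i`. -/
theorem sum_mul_sum_levelSet_eq (β α : Fin p → ℝ) (τ : ℝ) (z a : Fin p → ℝ) :
    ∑ j, (eta β α τ z j - β j) * (Real.sign (eta β α τ z j) /
        ((levelSet (eta β α τ z) j).card : ℝ) *
        ∑ k ∈ levelSet (eta β α τ z) j, τ * a ((ranking (eta β α τ z)).symm k))
      = ∑ i, gradNumer β α τ i z * a i := by
  simp only [gradNumer]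
  set η := eta β α τ z
  have hcard : ∀ {j k}, |η j| = |η k| → levelSet η j = levelSet η k := by
    intro j k h; ext l; rw [mem_levelSet, mem_levelSet, h]
  rw [← Equiv.sum_comp (ranking η).symm (fun i => 1 / ((levelSet η (ranking η i)).card : ℝ) *
    (∑ j ∈ levelSet η (ranking η i), (η j - β j) * Real.sign (η j) * τ) * a i)]
  simp only [Equiv.apply_symm_apply, Finset.mul_sum, Finset.sum_mul]
  have e1 : ∀ (g : Fin p → Fin p → ℝ), ∑ j, ∑ k ∈ levelSet η j, g j k
      = ∑ j, ∑ k, if |η k| = |η j| then g j k else 0 := fun g => by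
    simp only [levelSet, Finset.sum_filter]
  rw [e1, e1, Finset.sum_comm]
  refine Finset.sum_congr rfl fun k _ => Finset.sum_congr rfl fun j _ => ?_
  by_cases h : |η k| = |η j|
  · rw [if_pos h, if_pos h.symm, hcard h]
    ring
  · rw [if_neg h, if_neg (Ne.symm h)]

theorem hasFDerivWithinAt_sqErr (β : Fin p → ℝ) {α : Fin p → ℝ} (hα : α ∈ penaltyCone p) {τ : ℝ}
    (hτ : 0 < τ) : ∀ᵐ z ∂stdGaussian p, HasFDerivWithinAt (fun x => sqErr β x z)
      (sqErrDeriv β α τ z) (penaltyCone p ×ˢ Set.Ioi 0) (α, τ) := by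
  have hθ := mul_mem_penaltyCone hα hτ.le
  filter_upwards [ae_blockAverage_ne (fun i => α i * τ) β hτ.ne'] with z hz
  have hpat := eventually_pattern_eq hθ _ hz
  have hmap : Filter.Tendsto (fun x : (Fin p → ℝ) × ℝ =>
      ((fun i => x.1 i * x.2), fun k => β k + x.2 * z k))
      (nhdsWithin (α, τ) (penaltyCone p ×ˢ Set.Ioi 0))
      (nhdsWithin ((fun i => α i * τ), fun k => β k + τ * z k) (penaltyCone p ×ˢ Set.univ)) := by
    refine tendsto_nhdsWithin_iff.2 ⟨?_, ?_⟩
    · refine (Continuous.tendsto ?_ (α, τ)).mono_left nhdsWithin_le_nhds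
      fun_prop
    · filter_upwards [self_mem_nhdsWithin] with x hx
      exact ⟨mul_mem_penaltyCone hx.1 (le_of_lt hx.2), trivial⟩
  have hpat' := hmap.eventually hpat
  set η := eta β α τ z with hη
  have hloc : ∀ᶠ x in nhdsWithin (α, τ) (penaltyCone p ×ˢ Set.Ioi 0), sqErr β x z
      = ∑ j, (blockAverage (pattern η) (fun i => x.1 i * x.2) (fun k => β k + x.2 * z k) j
        - β j) ^ 2 := by
    filter_upwards [hpat', self_mem_nhdsWithin] with x hx hxS
    refine Finset.sum_congr rfl fun j _ => ?_
    rw [eta, prox_eq_blockAverage (mul_mem_penaltyCone hxS.1 (le_of_lt hxS.2)), hx]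
    rfl
  have hα_at : ∀ j, blockAverage (pattern η) (fun i => α i * τ) (fun k => β k + τ * z k) j
      = η j := fun j => (congrFun (prox_eq_blockAverage hθ _) j).symm
  refine HasFDerivWithinAt.congr_of_eventuallyEq ?_ hloc
    (Finset.sum_congr rfl fun j _ => by rw [hα_at])
  -- The fixed-pattern expression is smooth on the whole space; the cone matters only for its
  -- agreement with the squared error.
  refine HasFDerivAt.hasFDerivWithinAt ?_
  have hfst : ∀ i, HasFDerivAt (fun x : (Fin p → ℝ) × ℝ => x.1 i)
      ((ContinuousLinearMap.proj i : (Fin p → ℝ) →L[ℝ] ℝ).comp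
        (ContinuousLinearMap.fst ℝ (Fin p → ℝ) ℝ)) (α, τ) := fun i =>
    ((ContinuousLinearMap.proj i : (Fin p → ℝ) →L[ℝ] ℝ).comp
        (ContinuousLinearMap.fst ℝ (Fin p → ℝ) ℝ)).hasFDerivAt
  have hsnd : HasFDerivAt (fun x : (Fin p → ℝ) × ℝ => x.2)
      (ContinuousLinearMap.snd ℝ (Fin p → ℝ) ℝ) (α, τ) := hasFDerivAt_snd
  have hblock : ∀ j, HasFDerivAt (fun x : (Fin p → ℝ) × ℝ =>
      blockAverage (pattern η) (fun i => x.1 i * x.2) (fun k => β k + x.2 * z k) j)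
      ((Real.sign (η j) / ((levelSet η j).card : ℝ)) • ∑ k ∈ levelSet η j,
        (Real.sign (η k) • z k • ContinuousLinearMap.snd ℝ (Fin p → ℝ) ℝ -
          (α ((ranking η).symm k) • ContinuousLinearMap.snd ℝ (Fin p → ℝ) ℝ +
            τ • (ContinuousLinearMap.proj ((ranking η).symm k) : (Fin p → ℝ) →L[ℝ] ℝ).comp
              (ContinuousLinearMap.fst ℝ (Fin p → ℝ) ℝ)))) (α, τ) := by
    intro j
    simp only [blockAverage_pattern]
    refine HasFDerivAt.const_mul (HasFDerivAt.fun_sum fun k _ => ?_) _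
    exact (((hsnd.mul_const (z k)).const_add (β k)).const_mul _).sub ((hfst _).mul hsnd)
  refine (HasFDerivAt.fun_sum fun j _ => ((hblock j).sub_const (β j)).pow 2).congr_fderiv ?_
  refine ContinuousLinearMap.ext fun x => ?_
  obtain ⟨a, t⟩ := x
  have hsum := sum_mul_sum_levelSet_eq β α τ z a
  simp only [hα_at, sqErrDeriv, sum_apply, sub_apply,
    smul_apply, add_apply, ContinuousLinearMap.comp_apply,
    ContinuousLinearMap.coe_snd', ContinuousLinearMap.coe_fst', ContinuousLinearMap.proj_apply,
    smul_eq_mul]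
  have h2 : ∑ i, 2 * gradNumer β α τ i z * a i = 2 * ∑ i, gradNumer β α τ i z * a i := by
    rw [Finset.mul_sum]; exact Finset.sum_congr rfl fun _ _ => by ring
  rw [h2, ← hsum, Finset.mul_sum, Finset.mul_sum, Finset.sum_mul, ← Finset.sum_sub_distrib]
  refine Finset.sum_congr rfl fun j _ => ?_
  simp only [denomTerm, ← hη]
  have h3 : ∑ k ∈ levelSet η j, (Real.sign (η k) * (z k * t) - (α ((ranking η).symm k) * t
      + τ * a ((ranking η).symm k)))
      = (∑ k ∈ levelSet η j, (Real.sign (η k) * z k - α ((ranking η).symm k))) * t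
        - ∑ k ∈ levelSet η j, τ * a ((ranking η).symm k) := by
    rw [Finset.sum_mul, ← Finset.sum_sub_distrib]
    exact Finset.sum_congr rfl fun _ _ => by ring
  rw [h3]
  simp
  ring

/-- The mean squared error `E ‖η - β‖²`. -/
def mse (β : Fin p → ℝ) (x : (Fin p → ℝ) × ℝ) : ℝ :=
  ∫ z, sqErr β x z ∂stdGaussian p

theorem integrable_errBound (β : Fin p → ℝ) (R : ℝ) :
    Integrable (fun z : Fin p → ℝ => (1 + 16 * R ^ 2) * ∑ j, (z j) ^ 2 + 4 * p * R ^ 2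
      + 20 * ∑ j, (β j) ^ 2) (stdGaussian p) :=
  ((integrable_sum_sq.const_mul _).add (integrable_const _)).add (integrable_const _)

theorem integral_smul_sub_sum_smul {Ω ι E : Type*} [MeasurableSpace Ω] {μ : Measure Ω} [Fintype ι]
    [NormedAddCommGroup E] [NormedSpace ℝ E] [CompleteSpace E] {f : Ω → ℝ} {g : ι → Ω → ℝ}
    (hf : Integrable f μ) (hg : ∀ i, Integrable (g i) μ) (T : E) (P : ι → E) :
    Integrable (fun z => f z • T - ∑ i, g i z • P i) μ ∧
      ∫ z, (f z • T - ∑ i, g i z • P i) ∂μ = (∫ z, f z ∂μ) • T - ∑ i, (∫ z, g i z ∂μ) • P i := by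
  have h1 : Integrable (fun z => f z • T) μ := hf.smul_const T
  have h2 : ∀ i ∈ Finset.univ, Integrable (fun z => g i z • P i) μ := fun i _ =>
    (hg i).smul_const (P i)
  have h3 : Integrable (fun z => ∑ i, g i z • P i) μ := integrable_finsetSum _ h2
  refine ⟨h1.sub h3, ?_⟩
  rw [integral_sub h1 h3, integral_finsetSum _ h2]
  simp only [integral_smul_const]

theorem hasFDerivWithinAt_mse (β : Fin p → ℝ) {α : Fin p → ℝ} (hα : α ∈ penaltyCone p) {τ : ℝ}
    (hτ : 0 < τ) : HasFDerivWithinAt (mse β)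
      ((2 * ∑ j, ∫ z, denomTerm β α τ j z ∂stdGaussian p) •
          ContinuousLinearMap.snd ℝ (Fin p → ℝ) ℝ -
        ∑ i, (2 * ∫ z, gradNumer β α τ i z ∂stdGaussian p) •
          (ContinuousLinearMap.proj i : (Fin p → ℝ) →L[ℝ] ℝ).comp
            (ContinuousLinearMap.fst ℝ (Fin p → ℝ) ℝ))
      (penaltyCone p ×ˢ Set.Ioi 0) (α, τ) := by
  have hx₀ : ((α, τ) : (Fin p → ℝ) × ℝ) ∈ penaltyCone p ×ˢ Set.Ioi (0 : ℝ) := ⟨hα, hτ⟩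
  have hD : ∀ j ∈ Finset.univ, Integrable (denomTerm β α τ j) (stdGaussian p) := fun j _ =>
    integrable_denomTerm β hα hτ j
  have hf : Integrable (fun z => 2 * ∑ j, denomTerm β α τ j z) (stdGaussian p) :=
    (integrable_finsetSum _ hD).const_mul 2
  have hf' : ∫ z, 2 * ∑ j, denomTerm β α τ j z ∂stdGaussian p
      = 2 * ∑ j, ∫ z, denomTerm β α τ j z ∂stdGaussian p := by
    rw [integral_const_mul, integral_finsetSum _ hD]
  have hg : ∀ i, Integrable (fun z => 2 * gradNumer β α τ i z) (stdGaussian p) := fun i =>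
    (integrable_gradNumer β hα hτ i).const_mul 2
  obtain ⟨hint, heq⟩ := integral_smul_sub_sum_smul hf hg
    (ContinuousLinearMap.snd ℝ (Fin p → ℝ) ℝ) fun i =>
      (ContinuousLinearMap.proj i : (Fin p → ℝ) →L[ℝ] ℝ).comp
        (ContinuousLinearMap.fst ℝ (Fin p → ℝ) ℝ)
  rw [hf'] at heq
  simp only [integral_const_mul] at heq
  rw [← heq]
  refine integral_hasFDerivWithinAt_of_dominated (F := sqErr β) hx₀
    (fun x hx => integrable_sqErr β hx) hint
    (integrable_errBound β (‖((α, τ) : (Fin p → ℝ) × ℝ)‖ + 1)) ?_ (hasFDerivWithinAt_sqErr β hα hτ)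
  have hn : ∀ᶠ x in nhdsWithin ((α, τ) : (Fin p → ℝ) × ℝ) (penaltyCone p ×ˢ Set.Ioi (0 : ℝ)),
      ‖x‖ ≤ ‖((α, τ) : (Fin p → ℝ) × ℝ)‖ + 1 := by
    refine Filter.Eventually.filter_mono nhdsWithin_le_nhds ?_
    filter_upwards [(continuous_norm.tendsto ((α, τ) : (Fin p → ℝ) × ℝ)).eventually
      (gt_mem_nhds (lt_add_one _))] with x hx using le_of_lt hx
  filter_upwards [hn, self_mem_nhdsWithin] with x hx hxS z
  exact abs_sqErr_sub_le β hxS hx₀ hx (by linarith) z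

theorem continuousOn_mse (β : Fin p → ℝ) : ContinuousOn (mse β) (penaltyCone p ×ˢ Set.Ioi 0) :=
  fun x hx => (hasFDerivWithinAt_mse β (α := x.1) (τ := x.2) hx.1 hx.2).continuousWithinAt

/-! ### Monotonicity in `τ`, uniqueness and the sign of the denominator. -/

/-- The scaled error `‖η - β‖ / τ` does not increase with `τ`. -/
theorem sqErr_mul_sq_le (β : Fin p → ℝ) {α : Fin p → ℝ} (hα : α ∈ penaltyCone p) {s t : ℝ}
    (hs : 0 < s) (hst : s < t) (z : Fin p → ℝ) :
    sqErr β (α, t) z * s ^ 2 ≤ sqErr β (α, s) z * t ^ 2 := by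
  have ht : 0 < t := hs.trans hst
  -- The vector `z - (η - β) / r` is a subgradient of `J_α` at `η`: it is dominated by `J_α`
  -- everywhere, with equality at `η`. The penalty no longer involves `r`, so different values of
  -- `r` can be compared.
  have dual : ∀ {r : ℝ}, 0 < r → ∀ v : Fin p → ℝ,
      ∑ j, (z j - (eta β α r z j - β j) / r) * v j ≤ sortedL1 α v ∧
      sortedL1 α (eta β α r z) ≤ ∑ j, (z j - (eta β α r z j - β j) / r) * eta β α r z j := by
    intro r hr v
    have hθ := mul_mem_penaltyCone hα hr.le
    have hvi := (isProx_prox hθ (fun j => β j + r * z j)).sum_mul_le hθ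
    set η := eta β α r z with hη
    have hvi' : ∀ c : Fin p → ℝ, ∑ j, (z j - (η j - β j) / r) * (c j - η j)
        ≤ sortedL1 α c - sortedL1 α η := by
      intro c
      have h1 := hvi c
      rw [sortedL1_mul_right, sortedL1_mul_right, ← mul_sub] at h1
      refine le_of_mul_le_mul_left (le_trans (le_of_eq ?_) h1) hr
      rw [Finset.mul_sum]
      refine Finset.sum_congr rfl fun j _ => ?_
      rw [← mul_assoc]
      congr 1
      change r * (z j - (η j - β j) / r) = β j + r * z j - η j
      field_simp
      ring
    constructor
    · have h1 := hvi' (η + v)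
      have h2 := sortedL1_add_le hα η v
      simp only [Pi.add_apply, add_sub_cancel_left] at h1
      linarith
    · have h1 := hvi' 0
      rw [sortedL1_zero] at h1
      simp only [Pi.zero_apply, zero_sub, mul_neg, Finset.sum_neg_distrib] at h1
      linarith
  have h1 := (dual ht (eta β α s z)).1
  have h2 := (dual hs (eta β α s z)).2
  have h3 := (dual hs (eta β α t z)).1
  have h4 := (dual ht (eta β α t z)).2
  set w : Fin p → ℝ := fun j => (eta β α s z j - β j) / s with hw
  set w' : Fin p → ℝ := fun j => (eta β α t z j - β j) / t with hw'
  have hes : ∀ j, eta β α s z j = β j + s * w j := fun j => by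
    simp only [hw]; field_simp; ring
  have het : ∀ j, eta β α t z j = β j + t * w' j := fun j => by
    simp only [hw']; field_simp; ring
  have h5 : ∑ j, (s * w j - t * w' j) * (w j - w' j) ≤ 0 := by
    have : ∑ j, (s * w j - t * w' j) * (w j - w' j)
        = (∑ j, (z j - w' j) * eta β α s z j - ∑ j, (z j - w j) * eta β α s z j)
          + (∑ j, (z j - w j) * eta β α t z j - ∑ j, (z j - w' j) * eta β α t z j) := by
      rw [← Finset.sum_sub_distrib, ← Finset.sum_sub_distrib, ← Finset.sum_add_distrib]
      refine Finset.sum_congr rfl fun j _ => ?_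
      rw [hes, het]
      ring
    rw [this]
    linarith
  -- Termwise, the right side exceeds the left by `(s + t) / 2 * (w j - w' j)²`.
  have h6 : (t - s) / 2 * (∑ j, (w' j) ^ 2 - ∑ j, (w j) ^ 2)
      ≤ ∑ j, (s * w j - t * w' j) * (w j - w' j) := by
    rw [← Finset.sum_sub_distrib, Finset.mul_sum]
    refine Finset.sum_le_sum fun j _ => ?_
    nlinarith [mul_nonneg (add_pos hs ht).le (sq_nonneg (w j - w' j))]
  have h7 : ∑ j, (w' j) ^ 2 ≤ ∑ j, (w j) ^ 2 := by
    by_contra! h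
    have := mul_pos (half_pos (sub_pos.2 hst)) (sub_pos.2 h)
    linarith
  have h8 : sqErr β (α, s) z = s ^ 2 * ∑ j, (w j) ^ 2 := by
    rw [sqErr, Finset.mul_sum]
    exact Finset.sum_congr rfl fun j _ => by rw [hes]; ring
  have h9 : sqErr β (α, t) z = t ^ 2 * ∑ j, (w' j) ^ 2 := by
    rw [sqErr, Finset.mul_sum]
    exact Finset.sum_congr rfl fun j _ => by rw [het]; ring
  rw [h8, h9]
  have := mul_le_mul_of_nonneg_left h7 (mul_nonneg (sq_nonneg s) (sq_nonneg t))
  linarith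

theorem mse_mul_sq_le (β : Fin p → ℝ) {α : Fin p → ℝ} (hα : α ∈ penaltyCone p) {s t : ℝ}
    (hs : 0 < s) (hst : s < t) : mse β (α, t) * s ^ 2 ≤ mse β (α, s) * t ^ 2 := by
  simp only [mse]
  rw [← integral_mul_const, ← integral_mul_const]
  exact integral_mono ((integrable_sqErr β (x := (α, t)) ⟨hα, hs.trans hst⟩).mul_const _)
    ((integrable_sqErr β (x := (α, s)) ⟨hα, hs⟩).mul_const _)
    fun z => sqErr_mul_sq_le β hα hs hst z

/-- Averaging over level sets is self-adjoint and fixes vectors constant on them up to signs. -/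
theorem sum_mul_levelSet_average (b g v : Fin p → ℝ) (hg : ∀ j k, |b j| = |b k| → g j = g k) :
    ∑ j, Real.sign (b j) * g j * (Real.sign (b j) / ((levelSet b j).card : ℝ) *
      ∑ k ∈ levelSet b j, Real.sign (b k) * v k) = ∑ k, Real.sign (b k) * g k * v k := by
  simp only [Finset.mul_sum]
  have e1 : ∀ (f : Fin p → Fin p → ℝ), ∑ j, ∑ k ∈ levelSet b j, f j k
      = ∑ k, ∑ j ∈ levelSet b k, f j k := fun f => by
    simp only [levelSet, Finset.sum_filter]
    rw [Finset.sum_comm]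
    exact Finset.sum_congr rfl fun k _ => Finset.sum_congr rfl fun j _ => by
      simp only [eq_comm]
  rw [e1]
  refine Finset.sum_congr rfl fun k _ => ?_
  by_cases hk : b k = 0
  · simp [hk]
  have hc := card_levelSet_pos b k
  have : ∀ j ∈ levelSet b k, Real.sign (b j) * g j * (Real.sign (b j) /
      ((levelSet b j).card : ℝ) * (Real.sign (b k) * v k))
      = Real.sign (b k) * g k * v k / ((levelSet b k).card : ℝ) := by
    intro j hj
    rw [mem_levelSet] at hj
    have hj0 : b j ≠ 0 := by rw [← abs_ne_zero, hj]; exact abs_ne_zero.2 hk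
    have hlev : levelSet b j = levelSet b k := by
      ext l; rw [mem_levelSet, mem_levelSet, hj]
    have hs : Real.sign (b j) * Real.sign (b j) = 1 := by
      rcases Real.sign_apply_eq_of_ne_zero _ hj0 with h | h <;> simp [h]
    rw [hlev, hg j k hj]
    calc _ = (Real.sign (b j) * Real.sign (b j)) *
          (Real.sign (b k) * g k * v k / ((levelSet b k).card : ℝ)) := by ring
      _ = _ := by rw [hs, one_mul]
  rw [Finset.sum_congr rfl this, Finset.sum_const, nsmul_eq_mul]
  field_simp

/-- Let `m` be the orthogonal projection of `β` onto the signed block-constant vectors. Stationarity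
turns the left side into `⟨η - β, η - m⟩`. Since `η - m` is block constant, it is orthogonal to `m -
β`, and the deficit is `‖m - β‖²`. -/
theorem mul_sum_denomTerm_le (β : Fin p → ℝ) {α : Fin p → ℝ} (hα : α ∈ penaltyCone p) {τ : ℝ}
    (hτ : 0 < τ) (z : Fin p → ℝ) : τ * ∑ j, denomTerm β α τ j z ≤ sqErr β (α, τ) z := by
  have hθ := mul_mem_penaltyCone hα hτ.le
  have havg := (isProx_prox hθ (fun j => β j + τ * z j)).eq_average hθ
  change ∀ j, eta β α τ z j = _ at havg
  set η := eta β α τ z with hη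
  change ∀ j, η j = Real.sign (η j) / ((levelSet η j).card : ℝ) * ∑ k ∈ levelSet η j,
    (Real.sign (η k) * (β k + τ * z k) - α ((ranking η).symm k) * τ) at havg
  set g : Fin p → ℝ := fun j => |η j| - 1 / ((levelSet η j).card : ℝ) *
    ∑ k ∈ levelSet η j, Real.sign (η k) * β k with hg
  set m : Fin p → ℝ := fun j => Real.sign (η j) / ((levelSet η j).card : ℝ) *
    ∑ k ∈ levelSet η j, Real.sign (η k) * β k with hm
  have hgc : ∀ j k, |η j| = |η k| → g j = g k := by
    intro j k h
    have hlev : levelSet η j = levelSet η k := by ext l; rw [mem_levelSet, mem_levelSet, h]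
    simp only [hg, h, hlev]
  have hgm : ∀ j, Real.sign (η j) * g j = η j - m j := by
    intro j
    simp only [hg, hm, mul_sub, sign_mul_abs_eq_self]
    ring
  have horth : ∑ j, (η j - m j) * m j = ∑ j, (η j - m j) * β j := by
    have := sum_mul_levelSet_average η g β hgc
    simpa only [hgm] using this
  have hden : ∀ j, τ * denomTerm β α τ j z = (η j - β j) * (η j - m j) := by
    intro j
    have h1 : η j - m j = τ * (Real.sign (η j) / ((levelSet η j).card : ℝ) *
        ∑ k ∈ levelSet η j, (Real.sign (η k) * z k - α ((ranking η).symm k))) := by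
      conv_lhs => rw [havg j]
      simp only [hm]
      rw [← mul_sub, ← Finset.sum_sub_distrib, mul_left_comm τ]
      congr 1
      rw [Finset.mul_sum]
      exact Finset.sum_congr rfl fun k _ => by ring
    rw [h1]
    simp only [denomTerm, ← hη]
    ring
  have h2 : sqErr β (α, τ) z - τ * ∑ j, denomTerm β α τ j z
      = ∑ j, (m j - β j) ^ 2 + (∑ j, (η j - m j) * m j - ∑ j, (η j - m j) * β j) := by
    rw [Finset.mul_sum, sqErr, ← Finset.sum_sub_distrib, ← Finset.sum_sub_distrib,
      ← Finset.sum_add_distrib]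
    refine Finset.sum_congr rfl fun j _ => ?_
    rw [hden]
    change (η j - β j) ^ 2 - _ = _
    ring
  rw [horth, sub_self, add_zero] at h2
  have h3 : 0 ≤ ∑ j, (m j - β j) ^ 2 := Finset.sum_nonneg fun _ _ => sq_nonneg _
  linarith

theorem stateEvolution_iff (hp : 0 < p) {σw δ : ℝ} (hδ : 0 < δ) (β α : Fin p → ℝ) (τ : ℝ) :
    StateEvolution σw δ β α τ ↔ δ * p * (τ ^ 2 - σw ^ 2) - mse β (α, τ) = 0 := by
  have hp' : (0 : ℝ) < p := by exact_mod_cast hp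
  have h : 0 < δ * p := by positivity
  change τ ^ 2 = σw ^ 2 + 1 / (δ * p) * mse β (α, τ) ↔ _
  rw [← sub_eq_zero, ← mul_eq_zero_iff_left h.ne']
  have : (τ ^ 2 - (σw ^ 2 + 1 / (δ * p) * mse β (α, τ))) * (δ * p)
      = δ * p * (τ ^ 2 - σw ^ 2) - mse β (α, τ) := by field_simp; ring
  rw [mul_comm, this]

theorem denom_neg (hp : 0 < p) {σw δ : ℝ} (hσw : 0 < σw) (hδ : 0 < δ) (β : Fin p → ℝ)
    {α : Fin p → ℝ} (hα : α ∈ penaltyCone p) {τ : ℝ} (hτ : 0 < τ)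
    (hse : StateEvolution σw δ β α τ) : denom δ β α τ < 0 := by
  rw [stateEvolution_iff hp hδ] at hse
  have hp' : (0 : ℝ) < p := by exact_mod_cast hp
  have h1 : τ * ∑ j, ∫ z, denomTerm β α τ j z ∂stdGaussian p ≤ mse β (α, τ) := by
    rw [← integral_finsetSum _ fun j _ => integrable_denomTerm β hα hτ j, ← integral_const_mul]
    exact integral_mono ((integrable_finsetSum _ fun j _ =>
      integrable_denomTerm β hα hτ j).const_mul τ) (integrable_sqErr β (x := (α, τ)) ⟨hα, hτ⟩)
      fun z => mul_sum_denomTerm_le β hα hτ z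
  have h2 : τ * denom δ β α τ ≤ -(δ * p * σw ^ 2) := by
    rw [denom, mul_add]
    linarith
  have h3 : 0 < δ * p * σw ^ 2 := by positivity
  by_contra! h
  have := mul_nonneg hτ.le h
  linarith

/-- The state evolution residual, divided by `τ²`, is strictly increasing in `τ`. -/
theorem residual_mul_sq_lt (hp : 0 < p) {σw δ : ℝ} (hσw : 0 < σw) (hδ : 0 < δ) (β : Fin p → ℝ)
    {α : Fin p → ℝ} (hα : α ∈ penaltyCone p) {s t : ℝ} (hs : 0 < s) (hst : s < t) :
    (δ * p * (s ^ 2 - σw ^ 2) - mse β (α, s)) * t ^ 2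
      < (δ * p * (t ^ 2 - σw ^ 2) - mse β (α, t)) * s ^ 2 := by
  have hp' : (0 : ℝ) < p := by exact_mod_cast hp
  have h1 := mse_mul_sq_le β hα hs hst
  have h2 : s ^ 2 < t ^ 2 := pow_lt_pow_left₀ hst hs.le two_ne_zero
  have h3 : 0 < δ * p * σw ^ 2 := by positivity
  nlinarith [mul_lt_mul_of_pos_left h2 h3]

theorem stateEvolution_unique (hp : 0 < p) {σw δ : ℝ} (hσw : 0 < σw) (hδ : 0 < δ)
    (β : Fin p → ℝ) {α : Fin p → ℝ} (hα : α ∈ penaltyCone p) {s t : ℝ} (hs : 0 < s) (ht : 0 < t)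
    (hses : StateEvolution σw δ β α s) (hset : StateEvolution σw δ β α t) : s = t := by
  rw [stateEvolution_iff hp hδ] at hses hset
  rcases lt_trichotomy s t with h | h | h
  · have := residual_mul_sq_lt hp hσw hδ β hα hs h
    simp [hses, hset] at this
  · exact h
  · have := residual_mul_sq_lt hp hσw hδ β hα ht h
    simp [hses, hset] at this

/-! ### The implicit function `τ(α)`. -/

theorem tau_spec {σw δ : ℝ} {β α : Fin p → ℝ} (h : ∃ t : ℝ, 0 < t ∧ StateEvolution σw δ β α t) :
    0 < tau σw δ β α ∧ StateEvolution σw δ β α (tau σw δ β α) := by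
  rw [tau, dif_pos h]
  exact h.choose_spec

/-- Solvability is stable and the solution is continuous on the cone. -/
theorem eventually_solution_near (hp : 0 < p) {σw δ : ℝ} (hσw : 0 < σw) (hδ : 0 < δ)
    (β : Fin p → ℝ) {α : Fin p → ℝ} (hα : α ∈ penaltyCone p) {τ : ℝ} (hτ : 0 < τ)
    (hse : StateEvolution σw δ β α τ) {ε : ℝ} (hε : 0 < ε) (hετ : ε < τ) :
    ∀ᶠ α' in nhdsWithin α (penaltyCone p), (∃ t : ℝ, 0 < t ∧ StateEvolution σw δ β α' t) ∧
      |tau σw δ β α' - τ| ≤ ε := by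
  rw [stateEvolution_iff hp hδ] at hse
  -- The residual changes sign strictly across `τ`; both signs persist for nearby penalties, and the
  -- intermediate value theorem gives a root, which uniqueness identifies with `tau`.
  have hlo : δ * p * ((τ - ε) ^ 2 - σw ^ 2) - mse β (α, τ - ε) < 0 := by
    have h := residual_mul_sq_lt hp hσw hδ β hα (sub_pos.2 hετ) (sub_lt_self τ hε)
    rw [hse, zero_mul] at h
    by_contra! h0
    exact absurd h (not_lt.2 (mul_nonneg h0 (sq_nonneg _)))
  have hhi : 0 < δ * p * ((τ + ε) ^ 2 - σw ^ 2) - mse β (α, τ + ε) := by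
    have h := residual_mul_sq_lt hp hσw hδ β hα hτ (lt_add_of_pos_right τ hε)
    rw [hse, zero_mul] at h
    exact pos_of_mul_pos_left h (sq_nonneg _)
  have hcont : ∀ {t : ℝ}, 0 < t → Filter.Tendsto
      (fun α' => δ * p * (t ^ 2 - σw ^ 2) - mse β (α', t)) (nhdsWithin α (penaltyCone p))
      (nhds (δ * p * (t ^ 2 - σw ^ 2) - mse β (α, t))) := by
    intro t ht
    have h1 : Filter.Tendsto (fun α' : Fin p → ℝ => (α', t)) (nhdsWithin α (penaltyCone p))
        (nhdsWithin (α, t) (penaltyCone p ×ˢ Set.Ioi 0)) := by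
      refine tendsto_nhdsWithin_iff.2 ⟨?_, ?_⟩
      · exact (Continuous.tendsto (by fun_prop) α).mono_left nhdsWithin_le_nhds
      · filter_upwards [self_mem_nhdsWithin] with α' hα'
        exact ⟨hα', ht⟩
    exact ((continuousOn_mse β (α, t) ⟨hα, ht⟩).tendsto.comp h1).const_sub _
  filter_upwards [(hcont (sub_pos.2 hετ)).eventually (gt_mem_nhds hlo),
    (hcont (add_pos hτ hε)).eventually (lt_mem_nhds hhi), self_mem_nhdsWithin] with α' h1 h2 hα'
  have hc : ContinuousOn (fun t => δ * p * (t ^ 2 - σw ^ 2) - mse β (α', t))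
      (Set.Icc (τ - ε) (τ + ε)) := by
    refine ContinuousOn.sub (by fun_prop) ((continuousOn_mse β).comp (by fun_prop) ?_)
    intro t ht
    exact ⟨hα', lt_of_lt_of_le (sub_pos.2 hετ) ht.1⟩
  obtain ⟨t, ht, ht0⟩ := intermediate_value_Icc (by linarith) hc ⟨h1.le, h2.le⟩
  have htpos : 0 < t := lt_of_lt_of_le (sub_pos.2 hετ) ht.1
  have hex : ∃ t : ℝ, 0 < t ∧ StateEvolution σw δ β α' t :=
    ⟨t, htpos, (stateEvolution_iff hp hδ β α' t).2 ht0⟩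
  refine ⟨hex, ?_⟩
  have hspec := tau_spec hex
  rw [stateEvolution_unique hp hσw hδ β hα' hspec.1 htpos hspec.2
    ((stateEvolution_iff hp hδ β α' t).2 ht0), abs_le]
  constructor <;> linarith [ht.1, ht.2]

/-- An implicit function is differentiable at a point within a set as soon as it is continuous
there and the equation is differentiable there. -/
theorem hasFDerivWithinAt_of_implicit {E : Type*} [NormedAddCommGroup E] [NormedSpace ℝ E]
    {C : Set E} {S : Set (E × ℝ)} {x₀ : E} {Γ : E × ℝ → ℝ} {L : E × ℝ →L[ℝ] ℝ} {f : E → ℝ}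
    (hΓ : HasFDerivWithinAt Γ L S (x₀, f x₀)) (hc : L (0, 1) ≠ 0)
    (hf : Filter.Tendsto f (nhdsWithin x₀ C) (nhds (f x₀)))
    (hS : ∀ᶠ x in nhdsWithin x₀ C, (x, f x) ∈ S)
    (h0 : ∀ᶠ x in nhdsWithin x₀ C, Γ (x, f x) = Γ (x₀, f x₀)) {A : E →L[ℝ] ℝ}
    (hA : ∀ v, L (v, 0) = -(L (0, 1) * A v)) : HasFDerivWithinAt f A C x₀ := by
  rw [hasFDerivWithinAt_iff_isLittleO] at hΓ ⊢
  have hmap : Filter.Tendsto (fun x => (x, f x)) (nhdsWithin x₀ C)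
      (nhdsWithin (x₀, f x₀) S) :=
    tendsto_nhdsWithin_iff.2 ⟨(Filter.tendsto_id.mono_right nhdsWithin_le_nhds).prodMk_nhds hf, hS⟩
  have h1 := hΓ.comp_tendsto hmap
  -- `Γ` is constant along the graph, so `L` applied to the increment is itself the remainder, up to
  -- sign.
  have h2 : (fun x => L (0, 1) * (f x - f x₀ - A (x - x₀))) =o[nhdsWithin x₀ C]
      fun x => (x - x₀, f x - f x₀) := by
    refine h1.neg_left.congr' ?_ (Filter.EventuallyEq.of_eq (funext fun x => rfl))
    filter_upwards [h0] with x hx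
    have h3 : L ((x, f x) - (x₀, f x₀)) = L (x - x₀, 0) + (f x - f x₀) * L (0, 1) := by
      rw [← smul_eq_mul, ← map_smul, ← map_add]
      simp
    simp only [Function.comp, hx, sub_self, zero_sub, neg_neg, h3, hA]
    ring
  have h3 : (fun x => f x - f x₀ - A (x - x₀)) =o[nhdsWithin x₀ C]
      fun x => (x - x₀, f x - f x₀) := (Asymptotics.isLittleO_const_mul_left_iff hc).1 h2
  have h4 : (fun x => ((0 : E), f x - f x₀ - A (x - x₀))) =o[nhdsWithin x₀ C]
      fun x => (x - x₀, f x - f x₀) :=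
    (Asymptotics.isLittleO_zero _ _).prod_left h3
  -- The remainder is small compared with the full increment, so subtracting it keeps the order of
  -- magnitude; what is left is linear in `x - x₀`. No prior Lipschitz bound on `f` is needed.
  refine h3.trans_isBigO (h4.right_isBigO_sub.trans ?_)
  have h5 : ∀ x, (x - x₀, f x - f x₀) - ((0 : E), f x - f x₀ - A (x - x₀))
      = (ContinuousLinearMap.id ℝ E).prod A (x - x₀) := fun x => by simp
  simp only [h5]
  exact ContinuousLinearMap.isBigO_comp _ _ _

theorem hasFDerivWithinAt_tau (hp : 0 < p) {σw δ : ℝ} (hσw : 0 < σw) (hδ : 0 < δ)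
    (β : Fin p → ℝ) {α : Fin p → ℝ} (hα : α ∈ penaltyCone p)
    (hsol : ∃ t : ℝ, 0 < t ∧ StateEvolution σw δ β α t) :
    HasFDerivWithinAt (tau σw δ β)
      (∑ i, grad δ β α (tau σw δ β α) i • (ContinuousLinearMap.proj i : (Fin p → ℝ) →L[ℝ] ℝ))
      (penaltyCone p) α := by
  obtain ⟨hτ, hse⟩ := tau_spec hsol
  have hD := denom_neg hp hσw hδ β hα hτ hse
  set τ := tau σw δ β α with hτdef
  have hnear := fun {ε : ℝ} (hε : 0 < ε) (hετ : ε < τ) =>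
    eventually_solution_near hp hσw hδ β hα hτ hse hε hετ
  have hsolv : ∀ᶠ α' in nhdsWithin α (penaltyCone p),
      ∃ t : ℝ, 0 < t ∧ StateEvolution σw δ β α' t :=
    (hnear (half_pos hτ) (half_lt_self hτ)).mono fun _ h => h.1
  have hquad : HasFDerivWithinAt (fun x : (Fin p → ℝ) × ℝ => δ * p * (x.2 ^ 2 - σw ^ 2))
      ((δ * p * (2 * τ)) • ContinuousLinearMap.snd ℝ (Fin p → ℝ) ℝ)
      (penaltyCone p ×ˢ Set.Ioi 0) (α, τ) := by
    refine HasFDerivAt.hasFDerivWithinAt ?_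
    refine (((hasFDerivAt_snd (p := ((α, τ) : (Fin p → ℝ) × ℝ)) (𝕜 := ℝ)).pow 2).sub_const
      (σw ^ 2)).const_mul (δ * p) |>.congr_fderiv ?_
    ext x <;> simp
  have hΓ := hquad.sub (hasFDerivWithinAt_mse β hα hτ)
  refine hasFDerivWithinAt_of_implicit hΓ ?_ ?_ ?_ ?_ ?_
  -- The partial derivative of `Γ` in `τ` is `-2D`.
  · have h1 : 2 * denom δ β α τ ≠ 0 := mul_ne_zero two_ne_zero hD.ne
    simp [denom] at h1 ⊢
    intro h; apply h1; linarith
  · rw [Metric.tendsto_nhds]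
    intro ε hε
    have hm : 0 < min (ε / 2) (τ / 2) := by positivity
    filter_upwards [hnear hm (lt_of_le_of_lt (min_le_right _ _) (half_lt_self hτ))] with α' h
    rw [Real.dist_eq]
    exact lt_of_le_of_lt h.2 (lt_of_le_of_lt (min_le_left _ _) (half_lt_self hε))
  · filter_upwards [hsolv, self_mem_nhdsWithin] with α' h hα'
    exact ⟨hα', (tau_spec h).1⟩
  · filter_upwards [hsolv] with α' h
    have h1 := (stateEvolution_iff hp hδ β α' _).1 (tau_spec h).2
    have h2 := (stateEvolution_iff hp hδ β α _).1 hse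
    exact h1.trans h2.symm
  · intro v
    have hgrad : ∀ i, grad δ β α τ i
        = (denom δ β α τ)⁻¹ * ∫ z, gradNumer β α τ i z ∂stdGaussian p := fun i => by
      simp only [grad, gradTerm_eq, integral_const_mul]
    simp only [sub_apply, smul_apply, sum_apply, ContinuousLinearMap.comp_apply,
      ContinuousLinearMap.coe_snd', ContinuousLinearMap.coe_fst', ContinuousLinearMap.proj_apply,
      smul_eq_mul, Pi.zero_apply, mul_zero, mul_one, Finset.sum_const_zero, sub_zero, zero_sub,
      hgrad]
    have hD0 := hD.ne
    have h1 : δ * p * (2 * τ) - 2 * ∑ j, ∫ z, denomTerm β α τ j z ∂stdGaussian p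
        = -(2 * denom δ β α τ) := by rw [denom]; ring
    rw [h1, neg_mul, neg_neg, neg_neg, Finset.mul_sum]
    refine Finset.sum_congr rfl fun i _ => ?_
    field_simp

theorem penaltyCone_mem_nhds {α : Fin p → ℝ} (hα : StrictAnti α) (hpos : ∀ i, 0 < α i) :
    penaltyCone p ∈ nhds α := by
  have h1 : ∀ᶠ α' in nhds α, ∀ i j, i < j → α' j < α' i := by
    refine Filter.eventually_all.2 fun i => Filter.eventually_all.2 fun j => ?_
    by_cases hij : i < j
    · have hc : Filter.Tendsto (fun α' : Fin p → ℝ => α' i - α' j) (nhds α) (nhds (α i - α j)) :=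
        Continuous.tendsto (by fun_prop) α
      filter_upwards [hc.eventually (lt_mem_nhds (sub_pos.2 (hα hij)))] with α' h _
      exact sub_pos.1 h
    · exact Filter.Eventually.of_forall fun _ h => absurd h hij
  have h2 : ∀ᶠ α' in nhds α, ∀ i, 0 < α' i := by
    refine Filter.eventually_all.2 fun i => ?_
    exact (continuous_apply i).tendsto α |>.eventually (lt_mem_nhds (hpos i))
  filter_upwards [h1, h2] with α' h1 h2
  refine ⟨fun i j hij => ?_, fun i => (h2 i).le⟩
  rcases hij.eq_or_lt with h | h
  · rw [h]
  · exact (h1 i j h).le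

end SLOPE

end

theorem theorem1 {p : ℕ} (hp : 0 < p) (σw δ : ℝ) (hσw : 0 < σw) (hδ : 0 < δ)
    (β α : Fin p → ℝ) (hα : α ∈ SLOPE.penaltyCone p)
    (hsol : ∃ t : ℝ, 0 < t ∧ SLOPE.StateEvolution σw δ β α t) :
    -- the solution is unique, so that `τ(α)` is well defined
    (∃! t : ℝ, 0 < t ∧ SLOPE.StateEvolution σw δ β α t) ∧
    -- all expectations involved are expectations of integrable random variables
    Integrable (fun z => ∑ j, (SLOPE.eta β α (SLOPE.tau σw δ β α) z j - β j) ^ 2)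
      (SLOPE.stdGaussian p) ∧
    (∀ j, Integrable (SLOPE.denomTerm β α (SLOPE.tau σw δ β α) j) (SLOPE.stdGaussian p)) ∧
    (∀ i, Integrable (SLOPE.gradTerm δ β α (SLOPE.tau σw δ β α) i) (SLOPE.stdGaussian p)) ∧
    -- the denominator is negative
    SLOPE.denom δ β α (SLOPE.tau σw δ β α) < 0 ∧
    -- `τ` is differentiable on the cone of penalties, with the stated partial derivatives
    HasFDerivWithinAt (SLOPE.tau σw δ β)
      (∑ i, SLOPE.grad δ β α (SLOPE.tau σw δ β α) i •
        (ContinuousLinearMap.proj i : (Fin p → ℝ) →L[ℝ] ℝ))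
      (SLOPE.penaltyCone p) α ∧
    -- which are two-sided at interior points of the cone
    (StrictAnti α → (∀ i, 0 < α i) → ∀ i,
      HasDerivAt (fun t => SLOPE.tau σw δ β (Function.update α i t))
        (SLOPE.grad δ β α (SLOPE.tau σw δ β α) i) (α i)) := by
  obtain ⟨hτ, hse⟩ := SLOPE.tau_spec hsol
  have hderiv := SLOPE.hasFDerivWithinAt_tau hp hσw hδ β hα hsol
  refine ⟨⟨_, ⟨hτ, hse⟩, fun t ht => SLOPE.stateEvolution_unique hp hσw hδ β hα ht.1 hτ ht.2 hse⟩,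
    SLOPE.integrable_sqErr β (x := (α, SLOPE.tau σw δ β α)) ⟨hα, hτ⟩,
    fun j => SLOPE.integrable_denomTerm β hα hτ j, fun i => ?_,
    SLOPE.denom_neg hp hσw hδ β hα hτ hse, hderiv, fun hanti hpos i => ?_⟩
  · refine ((SLOPE.integrable_gradNumer β hα hτ i).const_mul
      (SLOPE.denom δ β α (SLOPE.tau σw δ β α))⁻¹).congr (Filter.Eventually.of_forall fun z => ?_)
    exact (SLOPE.gradTerm_eq δ β α _ i z).symm
  -- Here the cone is a neighbourhood of `α`, so the derivative is unrestricted and can be composed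
  -- with the coordinate line through `α`.
  · have h := hderiv.hasFDerivAt (SLOPE.penaltyCone_mem_nhds hanti hpos)
    rw [← Function.update_eq_self i α] at h
    have h1 := HasFDerivAt.comp_hasDerivAt (α i) h (hasDerivAt_update α i (α i))
    rw [Function.update_eq_self] at h1
    refine h1.congr_deriv ?_
    simp [Pi.single_apply]
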